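/- Let $\Omega\subset\mathbb R^3$ be a bounded open set of class $C^2$, $T>0$, $c_0\ge 0$, $V=H^1_0(\Omega)$, $\mathbf V=H^1_0(\Omega)^3$, with duals $V',\mathbf V'$, and let $(\cdot,\cdot)$ be the $L^2(\Omega)$ inner product. Let $k:\mathbb R\to\mathbb R$ be continuous with $0<k_1\le k(x)\le k_2$ for all $x\in\mathbb R$ and some constants $k_1,k_2$, and assume in addition that $k$ is globally Lipschitz. Let $\mathbf F\in L^2(0,T;L^2(\Omega)^3)\cap H^1(0,T;\mathbf V')$, $S\in L^2(0,T;V')$ and $d_0\in L^2(\Omega)$. For $\mathbf u,\mathbf w\in\mathbf V$ put $$e(\mathbf u,\mathbf w)=(\nabla\cdot\mathbf u,\nabla\cdot\mathbf w)+(\nabla\mathbf u,\nabla\mathbf w)+(\nabla\mathbf u,\nabla\mathbf w^T).$$ A pair $(\mathbf u,p)\in L^2(0,T;\mathbf V)\times L^2(0,T;V)$ is a weak solution if $\zeta=c_0p+\nabla\cdot\mathbf u\in L^2(0,T;L^2(\Omega))\cap H^1(0,T;V')$, if for all $\mathbf w\in L^2(0,T;\mathbf V)$ and $q\in L^2(0,T;V)$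 $$\int_0^T e(\mathbf u,\mathbf w)\,dt-\int_0^T(p,\nabla\cdot\mathbf w)\,dt=\int_0^T(\mathbf F,\mathbf w)\,dt,$$ $$\int_0^T(k(\zeta)\nabla p,\nabla q)\,dt+\int_0^T\langle\zeta_t,q\rangle_{V'\times V}\,dt=\int_0^T\langle S,q\rangle_{V'\times V}\,dt,$$ and if for every $q\in V$ the function $t\mapsto(\zeta(t),q)$ has an absolutely continuous representative on $[0,T]$ whose value at $t=0$ is $(d_0,q)$. Let $\mathcal W_T$ be the set of weak solutions $(\mathbf u,p)$ (for the given data) with $p_t\in L^2(0,T;L^2(\Omega))$. Suppose that $(\mathbf u,p)\in\mathcal W_T$ satisfies $p\in L^2(0,T;W^{1,\infty}(\Omega))$, that is, $p(t)\in W^{1,\infty}(\Omega)$ for almost every $t$ and $t\mapsto\|p(t)\|_{W^{1,\infty}(\Omega)}$ is in $L^2(0,T)$, and that at least one of the following holds: (a) $d_0=\nabla\cdot\mathbf u_0+c_0p_0$ for some $\mathbf u_0\in\mathbf V$ and $p_0\in L^2(\Omega)$; (b) $c_0>0$. Then $(\mathbf u,p)$ is the only element of $\mathcal W_T$: every $(\mathbf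 v,q)\in\mathcal W_T$ satisfies $\mathbf v(t)=\mathbf u(t)$ in $\mathbf V$ and $q(t)=p(t)$ in $V$ for almost every $t\in(0,T)$. -/

import Mathlib

open MeasureTheory Set
open scoped ContDiff NNReal ENNReal

noncomputable section

namespace Biot

/-- Three-dimensional Euclidean space. -/
abbrev E3 : Type := EuclideanSpace ℝ (Fin 3)

/-- A bounded open subset of `ℝ³` of class `C²`: near each boundary point there is a
`C²` diffeomorphism between open sets that carries `Ω` to the half space `{y | 0 < y 0}`. -/
structure IsC2Domain (Ω : Set E3) : Prop where
  isOpen : IsOpen Ω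
  isBounded : Bornology.IsBounded Ω
  boundary : ∀ x ∈ frontier Ω, ∃ ψ : OpenPartialHomeomorph E3 E3, x ∈ ψ.source ∧
    ContDiffOn ℝ 2 ψ ψ.source ∧ ContDiffOn ℝ 2 ψ.symm ψ.target ∧
    ψ '' (Ω ∩ ψ.source) = {y | 0 < y 0} ∩ ψ.target

/-! ### Function spaces on `Ω` -/

/-- `L²(Ω)`. -/
abbrev L2 (Ω : Set E3) : Type := Lp ℝ 2 (volume.restrict Ω)

/-- `L²(Ω)³`. -/
abbrev L2Vec (Ω : Set E3) : Type := PiLp 2 (fun _ : Fin 3 => L2 Ω)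

/-- The pairs `(φ, ∇φ)` with `φ ∈ C_c^∞(Ω)`, as a subspace of `L²(Ω) × L²(Ω)³`. The norm of the
ambient space restricts to the `H¹(Ω)` norm of `φ`. -/
def testPairs (Ω : Set E3) : Submodule ℝ (WithLp 2 (L2 Ω × L2Vec Ω)) where
  carrier := {v | ∃ φ : E3 → ℝ, ContDiff ℝ ∞ φ ∧ HasCompactSupport φ ∧ tsupport φ ⊆ Ω ∧
    v.fst =ᵐ[volume.restrict Ω] φ ∧
    ∀ i : Fin 3, v.snd i =ᵐ[volume.restrict Ω]
      fun x => fderiv ℝ φ x (EuclideanSpace.single i 1)}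
  add_mem' := by
    rintro v w ⟨φ, h1, h2, h3, h4, h5⟩ ⟨ψ, k1, k2, k3, k4, k5⟩
    refine ⟨φ + ψ, h1.add k1, h2.add k2,
      (tsupport_add φ ψ).trans (union_subset h3 k3), ?_, fun i => ?_⟩
    · filter_upwards [h4, k4, Lp.coeFn_add v.fst w.fst] with x a b c
      simp only [WithLp.add_fst]
      rw [c, Pi.add_apply, Pi.add_apply, a, b]
    · filter_upwards [h5 i, k5 i, Lp.coeFn_add (v.snd i) (w.snd i)] with x a b c
      simp only [WithLp.add_snd, PiLp.add_apply]
      rw [c, Pi.add_apply, a, b,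
        fderiv_add (h1.differentiable (by simp) x) (k1.differentiable (by simp) x)]
      rfl
  zero_mem' := by
    refine ⟨0, contDiff_const, HasCompactSupport.zero, by simp [tsupport], ?_, fun i => ?_⟩
    · exact Lp.coeFn_zero _ _ _
    · filter_upwards [Lp.coeFn_zero ℝ 2 (volume.restrict Ω)] with x a
      simp only [WithLp.zero_snd, PiLp.zero_apply]
      rw [a]
      simp
  smul_mem' := by
    rintro c v ⟨φ, h1, h2, h3, h4, h5⟩
    refine ⟨c • φ, h1.const_smul c, h2.smul_left (f := fun _ => c),
      (tsupport_smul_subset_right (fun _ => c) φ).trans h3, ?_, fun i => ?_⟩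
    · filter_upwards [h4, Lp.coeFn_smul c v.fst] with x a b
      simp only [WithLp.smul_fst]
      rw [b, Pi.smul_apply, Pi.smul_apply, a]
    · filter_upwards [h5 i, Lp.coeFn_smul c (v.snd i)] with x a b
      simp only [WithLp.smul_snd, PiLp.smul_apply]
      rw [b, Pi.smul_apply, a, fderiv_const_smul (h1.differentiable (by simp) x)]
      rfl

/-- `V = H¹₀(Ω)`, the closure of `C_c^∞(Ω)` in the `H¹` norm; an element is carried together
with its weak gradient. -/
def H10 (Ω : Set E3) : Type := (testPairs Ω).topologicalClosure

instance (Ω : Set E3) : NormedAddCommGroup (H10 Ω) :=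
  inferInstanceAs (NormedAddCommGroup (testPairs Ω).topologicalClosure)

instance (Ω : Set E3) : InnerProductSpace ℝ (H10 Ω) :=
  inferInstanceAs (InnerProductSpace ℝ (testPairs Ω).topologicalClosure)

instance (Ω : Set E3) : CompleteSpace (H10 Ω) :=
  inferInstanceAs (CompleteSpace (testPairs Ω).topologicalClosure)

/-- The map `v ↦ (v, ∇v)` from `H¹₀(Ω)` to `L²(Ω) × L²(Ω)³`. -/
def graph (Ω : Set E3) : H10 Ω →L[ℝ] WithLp 2 (L2 Ω × L2Vec Ω) :=
  (testPairs Ω).topologicalClosure.subtypeL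

/-- `𝐕 = H¹₀(Ω)³`. -/
abbrev H10Vec (Ω : Set E3) : Type := PiLp 2 (fun _ : Fin 3 => H10 Ω)

/-- The inclusion `H¹₀(Ω) → L²(Ω)`. -/
def val (Ω : Set E3) : H10 Ω →L[ℝ] L2 Ω :=
  (WithLp.fstL 2 ℝ (L2 Ω) (L2Vec Ω)).comp (graph Ω)

/-- The weak partial derivative `∂ᵢ : H¹₀(Ω) → L²(Ω)`. -/
def pd (Ω : Set E3) (i : Fin 3) : H10 Ω →L[ℝ] L2 Ω :=
  (PiLp.proj 2 (fun _ : Fin 3 => L2 Ω) i).comp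
    ((WithLp.sndL 2 ℝ (L2 Ω) (L2Vec Ω)).comp (graph Ω))

/-- The `i`-th component `𝐕 → V`. -/
def comp (Ω : Set E3) (i : Fin 3) : H10Vec Ω →L[ℝ] H10 Ω :=
  PiLp.proj 2 (fun _ : Fin 3 => H10 Ω) i

/-- The divergence `𝐕 → L²(Ω)`. -/
def dvg (Ω : Set E3) : H10Vec Ω →L[ℝ] L2 Ω :=
  ∑ i : Fin 3, (pd Ω i).comp (comp Ω i)

/-- The elasticity form
`e(u, w) = (∇·u, ∇·w) + (∇u, ∇w) + (∇u, ∇wᵀ)`, with `(∇u)ᵢⱼ = ∂ⱼuᵢ`. -/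
def elast {Ω : Set E3} (u w : H10Vec Ω) : ℝ :=
  inner ℝ (dvg Ω u) (dvg Ω w)
    + ∑ i : Fin 3, ∑ j : Fin 3, inner ℝ (pd Ω j (u i)) (pd Ω j (w i))
    + ∑ i : Fin 3, ∑ j : Fin 3, inner ℝ (pd Ω j (u i)) (pd Ω i (w j))

/-- `L²(Ω) ⊂ V'`: the functional `q ↦ (f, q)_{L²(Ω)}`. -/
def toDual {Ω : Set E3} (f : L2 Ω) : StrongDual ℝ (H10 Ω) :=
  (innerSL ℝ f).comp (val Ω)

/-- `L²(Ω)³ ⊂ 𝐕'`: the functional `w ↦ (F, w)_{L²(Ω)³}`. -/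
def toDualVec {Ω : Set E3} (F : L2Vec Ω) : StrongDual ℝ (H10Vec Ω) :=
  ∑ i : Fin 3, (innerSL ℝ (F i)).comp ((val Ω).comp (comp Ω i))

/-- The `W^{1,∞}(Ω)` norm (possibly `∞`) of an element of `H¹₀(Ω)`. -/
def w1InfNorm {Ω : Set E3} (p : H10 Ω) : ℝ≥0∞ :=
  eLpNorm (val Ω p) ⊤ (volume.restrict Ω)
    + ∑ i : Fin 3, eLpNorm (pd Ω i p) ⊤ (volume.restrict Ω)

/-! ### Functions of time -/

/-- Lebesgue measure on `(0, T)`. -/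
abbrev timeMeasure (T : ℝ) : Measure ℝ := volume.restrict (Ioo 0 T)

/-- `f ∈ L²(0, T; X)`, in the sense of Bochner. -/
abbrev MemL2Time {X : Type*} [NormedAddCommGroup X] (T : ℝ) (f : ℝ → X) : Prop :=
  MemLp f 2 (timeMeasure T)

/-- `g` is the derivative of `f` in the sense of `X`-valued distributions on `(0, T)`. -/
def HasWeakTimeDeriv {X : Type*} [NormedAddCommGroup X] [NormedSpace ℝ X]
    (T : ℝ) (f g : ℝ → X) : Prop :=
  ∀ φ : ℝ → ℝ, ContDiff ℝ ∞ φ → HasCompactSupport φ → tsupport φ ⊆ Ioo 0 T →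
    ∫ t, deriv φ t • f t ∂timeMeasure T = - ∫ t, φ t • g t ∂timeMeasure T

/-- `f` has a weak derivative `f_t ∈ L²(0, T; X)`. -/
def WeakTimeDerivInL2 {X : Type*} [NormedAddCommGroup X] [NormedSpace ℝ X]
    (T : ℝ) (f : ℝ → X) : Prop :=
  ∃ g : ℝ → X, MemL2Time T g ∧ HasWeakTimeDeriv T f g

/-- `f ∈ H¹(0, T; X)`. -/
def MemH1Time {X : Type*} [NormedAddCommGroup X] [NormedSpace ℝ X]
    (T : ℝ) (f : ℝ → X) : Prop :=
  MemL2Time T f ∧ WeakTimeDerivInL2 T f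

/-- `p ∈ L²(0, T; W^{1,∞}(Ω))` for an `H¹₀(Ω)`-valued `p`: almost every `p t` lies in `W^{1,∞}(Ω)`
and the norm is square integrable in time. Strong measurability with values in the
non-separable space `W^{1,∞}(Ω)` is not asked for. -/
def MemL2W1Inf {Ω : Set E3} (T : ℝ) (p : ℝ → H10 Ω) : Prop :=
  (∀ᵐ t ∂timeMeasure T, w1InfNorm (p t) < ⊤) ∧
    MemL2Time T (fun t => (w1InfNorm (p t)).toReal)

/-! ### The nonlinear poroelastic system -/

/-- The permeability is continuous and bounded between two positive constants. -/
def PermeabilityBounds (k : ℝ → ℝ) : Prop :=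
  Continuous k ∧ ∃ k₁ k₂ : ℝ, 0 < k₁ ∧ 0 < k₂ ∧ ∀ x, k₁ ≤ k x ∧ k x ≤ k₂

/-- The form `(k(z) ∇p, ∇q)_{L²(Ω)}`. -/
def diffusion {Ω : Set E3} (k : ℝ → ℝ) (z : L2 Ω) (p q : H10 Ω) : ℝ :=
  ∫ x in Ω, k (z x) * ∑ i : Fin 3, pd Ω i p x * pd Ω i q x

/-- The fluid content `ζ = c₀ p + ∇·u`. -/
def fluidContent {Ω : Set E3} (c₀ : ℝ) (u : H10Vec Ω) (p : H10 Ω) : L2 Ω :=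
  c₀ • val Ω p + dvg Ω u

/-- `(u, p)` is a weak solution on `[0, T]` of
`-∇·[2ε(u) + (∇·u)I - pI] = F`, `ζ_t - ∇·[k(ζ)∇p] = S`, `ζ = c₀p + ∇·u`, with homogeneous
Dirichlet conditions for `u` and `p`, and `ζ(0) = d₀`. -/
structure IsWeakSolution {Ω : Set E3} (T c₀ : ℝ) (k : ℝ → ℝ) (F : ℝ → L2Vec Ω)
    (S : ℝ → StrongDual ℝ (H10 Ω)) (d₀ : L2 Ω) (u : ℝ → H10Vec Ω) (p : ℝ → H10 Ω) : Prop where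
  memL2_u : MemL2Time T u
  memL2_p : MemL2Time T p
  elasticity : ∀ w : ℝ → H10Vec Ω, MemL2Time T w →
    (∫ t, elast (u t) (w t) ∂timeMeasure T)
        - ∫ t, inner ℝ (val Ω (p t)) (dvg Ω (w t)) ∂timeMeasure T
      = ∫ t, ∑ i : Fin 3, inner ℝ (F t i) (val Ω (w t i)) ∂timeMeasure T
  pressure : ∃ ζ' : ℝ → StrongDual ℝ (H10 Ω), MemL2Time T ζ' ∧
    HasWeakTimeDeriv T (fun t => toDual (fluidContent c₀ (u t) (p t))) ζ' ∧
    ∀ q : ℝ → H10 Ω, MemL2Time T q →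
      (∫ t, diffusion k (fluidContent c₀ (u t) (p t)) (p t) (q t) ∂timeMeasure T)
          + ∫ t, ζ' t (q t) ∂timeMeasure T
        = ∫ t, S t (q t) ∂timeMeasure T
  /-- `t ↦ (ζ(t), q)` has an absolutely continuous representative on `[0, T]`, with value
  `(d₀, q)` at `t = 0`. -/
  initial : ∀ q : H10 Ω, ∃ g : ℝ → ℝ, AbsolutelyContinuousOnInterval g 0 T ∧
    (∀ᵐ t ∂timeMeasure T, g t = inner ℝ (fluidContent c₀ (u t) (p t)) (val Ω q)) ∧
    g 0 = inner ℝ d₀ (val Ω q)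

/-- The class `𝒲_T` of weak solutions with `p_t ∈ L²(0, T; L²(Ω))`. -/
def classW {Ω : Set E3} (T c₀ : ℝ) (k : ℝ → ℝ) (F : ℝ → L2Vec Ω)
    (S : ℝ → StrongDual ℝ (H10 Ω)) (d₀ : L2 Ω) : Set ((ℝ → H10Vec Ω) × (ℝ → H10 Ω)) :=
  {s | IsWeakSolution T c₀ k F S d₀ s.1 s.2 ∧ WeakTimeDerivInL2 T (fun t => val Ω (s.2 t))}

end Biot

end

open Biot

/-!
Let `P = q - p` be the difference of two pressures. Integrating by parts, `(∇u, ∇uᵀ) = ‖∇·u‖²` on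
`𝐕`, so the elasticity form is coercive without Korn's inequality. The elasticity equation then
determines `v - u` from `P`, and the fluid contents differ by `A P`, where `A` is `c₀` plus the
divergence of the elastic solution operator, a positive operator on `L²(Ω)`. Testing the difference
of the pressure equations with `P`, and using that `k` is Lipschitz and that `∇p(t)` is bounded by
`N(t) = ‖p(t)‖_{W^{1,∞}}`, gives
`(κ / 2) ‖∇P‖² + (1 / 2) d/dt (A P, P) ≤ K N(t)² (A P, P)`
with `N² ∈ L¹(0, T)`, so that Grönwall's lemma applies. The initial energy vanishes because `A P(0)`
is orthogonal to `V`, whereas `P(0)` is the limit in `L²(Ω)` of values `P(t) ∈ V`. Hence `∇P = 0`,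
so `P = 0` and `v = u`.
-/

open Filter Topology

noncomputable section

namespace Biot

/-! ### Absolutely continuous functions -/

section AbsolutelyContinuous

variable {X Y : Type*} [NormedAddCommGroup X] [NormedSpace ℝ X] [NormedAddCommGroup Y]
  [NormedSpace ℝ Y] {a b : ℝ}

theorem absolutelyContinuousOnInterval_of_dist_le_mul {X Y : Type*} [PseudoMetricSpace X]
    [PseudoMetricSpace Y] {f : ℝ → X} {g : ℝ → Y} (hg : AbsolutelyContinuousOnInterval g a b)
    (K : ℝ) (h : ∀ x ∈ uIcc a b, ∀ y ∈ uIcc a b, dist (f x) (f y) ≤ K * dist (g x) (g y)) :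
    AbsolutelyContinuousOnInterval f a b := by
  have hK : Tendsto (fun E : ℕ × (ℕ → ℝ × ℝ) =>
      K * ∑ i ∈ Finset.range E.1, dist (g (E.2 i).1) (g (E.2 i).2))
      (AbsolutelyContinuousOnInterval.totalLengthFilter ⊓
        𝓟 (AbsolutelyContinuousOnInterval.disjWithin a b)) (𝓝 0) := by
    simpa only [mul_zero] using Tendsto.const_mul K hg
  refine squeeze_zero' (Eventually.of_forall fun _ => Finset.sum_nonneg fun _ _ => dist_nonneg)
    ?_ hK
  rw [eventually_inf_principal]
  filter_upwards with E hE
  rw [Finset.mul_sum]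
  exact Finset.sum_le_sum fun i hi => h _ (hE.1 i hi).1 _ (hE.1 i hi).2

theorem absolutelyContinuousOnInterval_contDiff_comp {f : ℝ → X} {φ : X → Y}
    (hφ : ContDiff ℝ 1 φ) (hf : AbsolutelyContinuousOnInterval f a b) :
    AbsolutelyContinuousOnInterval (fun t => φ (f t)) a b := by
  obtain ⟨K, hK⟩ := (hφ.locallyLipschitz.locallyLipschitzOn
    (s := f '' uIcc a b)).exists_lipschitzOnWith_of_compact
    (isCompact_uIcc.image_of_continuousOn hf.continuousOn)
  exact absolutelyContinuousOnInterval_of_dist_le_mul hf K fun x hx y hy =>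
    hK.dist_le_mul _ (mem_image_of_mem f hx) _ (mem_image_of_mem f hy)

theorem absolutelyContinuousOnInterval_const_add_primitive {g : ℝ → X}
    (hg : IntervalIntegrable g volume a b) (c : X) :
    AbsolutelyContinuousOnInterval (fun t => c + ∫ s in a..t, g s) a b := by
  refine absolutelyContinuousOnInterval_of_dist_le_mul
    (hg.norm.absolutelyContinuousOnInterval_intervalIntegral left_mem_uIcc) 1 fun x hx y hy => ?_
  have hsub : ∀ z ∈ uIcc a b, IntervalIntegrable g volume a z := fun z hz =>
    hg.mono_set (uIcc_subset_uIcc left_mem_uIcc hz)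
  rw [one_mul, dist_add_left, dist_eq_norm, dist_eq_norm,
    intervalIntegral.integral_interval_sub_left (hsub x hx) (hsub y hy),
    intervalIntegral.integral_interval_sub_left (hsub x hx).norm (hsub y hy).norm]
  exact intervalIntegral.norm_integral_le_abs_integral_norm

theorem absolutelyContinuousOnInterval_primitive {g : ℝ → X}
    (hg : IntervalIntegrable g volume a b) :
    AbsolutelyContinuousOnInterval (fun t => ∫ s in a..t, g s) a b := by
  simpa only [zero_add] using absolutelyContinuousOnInterval_const_add_primitive hg 0

theorem ae_hasDerivAt_primitive [CompleteSpace X] {g : ℝ → X}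
    (hg : IntervalIntegrable g volume a b) :
    ∀ᵐ t, t ∈ uIcc a b → HasDerivAt (fun t => ∫ s in a..t, g s) (g t) t := by
  filter_upwards [hg.ae_hasDerivAt_integral] with t h ht using h ht a left_mem_uIcc

theorem integral_eq_sub_of_ae_hasDerivAt [CompleteSpace X] {f f' : ℝ → X}
    (hf : AbsolutelyContinuousOnInterval f a b) (hf' : IntervalIntegrable f' volume a b)
    (h : ∀ᵐ t, t ∈ uIcc a b → HasDerivAt f (f' t) t) :
    ∫ t in a..b, f' t = f b - f a := by
  have hd : ∀ᵐ t, t ∈ uIcc a b → HasDerivAt (fun t => f t - ∫ s in a..t, f' s) 0 t := by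
    filter_upwards [h, ae_hasDerivAt_primitive hf'] with t h1 h2 ht
    simpa only [sub_self] using (h1 ht).fun_sub (h2 ht)
  obtain ⟨C, hC⟩ :=
    (hf.fun_sub (absolutelyContinuousOnInterval_primitive hf')).const_of_ae_hasDerivAt_zero hd
  have hab := (hC b right_mem_uIcc).trans (hC a left_mem_uIcc).symm
  rw [intervalIntegral.integral_same, sub_zero] at hab
  rw [← hab, sub_sub_cancel]

theorem le_of_ae_deriv_nonpos {f : ℝ → ℝ} (hab : a ≤ b)
    (hf : AbsolutelyContinuousOnInterval f a b) (h : ∀ᵐ t, t ∈ Icc a b → deriv f t ≤ 0) :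
    f b ≤ f a := by
  have hint : 0 ≤ ∫ t in a..b, -deriv f t :=
    intervalIntegral.integral_nonneg_of_ae_restrict hab <|
      (ae_restrict_iff' measurableSet_Icc).2 <| h.mono fun t ht hmem => neg_nonneg.2 (ht hmem)
  rw [intervalIntegral.integral_neg, hf.integral_deriv_eq_sub] at hint
  linarith

end AbsolutelyContinuous

section Energy

theorem eq_zero_of_le_integral_mul {f α : ℝ → ℝ} {a b : ℝ} (hab : a ≤ b)
    (hf : ContinuousOn f (Icc a b)) (hf0 : ∀ t ∈ Icc a b, 0 ≤ f t)
    (hα : IntervalIntegrable α volume a b) (hα0 : ∀ t, 0 ≤ α t)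
    (h : ∀ t ∈ Icc a b, f t ≤ ∫ s in a..t, α s * f s) :
    ∀ t ∈ Icc a b, f t = 0 := by
  have hu : uIcc a b = Icc a b := uIcc_of_le hab
  have hαf : IntervalIntegrable (fun s => α s * f s) volume a b :=
    hα.mul_continuousOn (by rwa [hu])
  -- Grönwall's argument: `Φ exp(-A)` is nonincreasing and vanishes at `a`.
  set A : ℝ → ℝ := fun t => ∫ s in a..t, α s
  set Φ : ℝ → ℝ := fun t => ∫ s in a..t, α s * f s
  have hΨ : AbsolutelyContinuousOnInterval (fun t => Φ t * Real.exp (-A t)) a b :=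
    (absolutelyContinuousOnInterval_primitive hαf).fun_mul <|
      absolutelyContinuousOnInterval_contDiff_comp Real.contDiff_exp
        (absolutelyContinuousOnInterval_primitive hα).fun_neg
  have hderiv : ∀ᵐ t, t ∈ uIcc a b → deriv (fun t => Φ t * Real.exp (-A t)) t ≤ 0 := by
    filter_upwards [ae_hasDerivAt_primitive hα, ae_hasDerivAt_primitive hαf] with t hA hΦ ht
    rw [((hΦ ht).fun_mul (hA ht).fun_neg.exp).deriv]
    have hle := mul_le_mul_of_nonneg_left (h t (hu ▸ ht)) (hα0 t)
    have hprod : 0 ≤ (α t * Φ t - α t * f t) * Real.exp (-A t) :=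
      mul_nonneg (sub_nonneg.2 hle) (Real.exp_pos _).le
    linarith
  intro t ht
  have hsub : uIcc a t ⊆ uIcc a b := uIcc_subset_uIcc left_mem_uIcc (hu ▸ ht)
  have hdecr := le_of_ae_deriv_nonpos ht.1 (hΨ.mono hsub) <|
    hderiv.mono fun s hs hmem => hs (hsub (uIcc_of_le ht.1 ▸ hmem))
  have hΦ : Φ t ≤ 0 := by
    simp only [Φ, intervalIntegral.integral_same, zero_mul] at hdecr
    exact nonpos_of_mul_nonpos_left hdecr (Real.exp_pos _)
  exact le_antisymm ((h t ht).trans hΦ) (hf0 t ht)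

variable {H : Type*} [NormedAddCommGroup H] [InnerProductSpace ℝ H] {A : H →L[ℝ] H}

theorem norm_apply_sq_le_of_isPositive (hA : A.IsPositive) (x : H) :
    ‖A x‖ ^ 2 ≤ ‖A‖ * inner ℝ (A x) x := by
  let B : LinearMap.BilinForm ℝ H := (innerₗ H).comp A.toLinearMap
  have cauchy_schwarz : inner ℝ (A x) (A x) ^ 2 ≤ inner ℝ (A x) x * inner ℝ (A (A x)) (A x) :=
    LinearMap.BilinForm.apply_sq_le_of_symm B hA.inner_nonneg_left
      ⟨fun y z => by simpa [B, real_inner_comm] using hA.inner_left_eq_inner_right y z⟩ x (A x)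
  have hAA : inner ℝ (A (A x)) (A x) ≤ ‖A‖ * ‖A x‖ ^ 2 :=
    calc inner ℝ (A (A x)) (A x) ≤ ‖A (A x)‖ * ‖A x‖ := real_inner_le_norm _ _
      _ ≤ ‖A‖ * ‖A x‖ * ‖A x‖ := by gcongr; exact A.le_opNorm _
      _ = ‖A‖ * ‖A x‖ ^ 2 := by ring
  rw [real_inner_self_eq_norm_sq] at cauchy_schwarz
  have hx : 0 ≤ inner ℝ (A x) x := hA.inner_nonneg_left x
  rcases (norm_nonneg (A x)).eq_or_lt with h0 | hpos
  · simpa only [← h0, zero_pow two_ne_zero] using mul_nonneg (norm_nonneg A) hx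
  · have := cauchy_schwarz.trans (mul_le_mul_of_nonneg_left hAA hx)
    refine le_of_mul_le_mul_right ?_ (pow_pos hpos 2)
    linarith

theorem intervalIntegrable_clm_apply₂ {X Y Z : Type*} [NormedAddCommGroup X] [NormedSpace ℝ X]
    [NormedAddCommGroup Y] [NormedSpace ℝ Y] [NormedAddCommGroup Z] [NormedSpace ℝ Z]
    (M : X →L[ℝ] Y →L[ℝ] Z) {f : ℝ → X} {g : ℝ → Y} {a b : ℝ}
    (hf : IntervalIntegrable f volume a b) (hg : ContinuousOn g (uIcc a b)) :
    IntervalIntegrable (fun t => M (f t) (g t)) volume a b := by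
  obtain ⟨C, hC⟩ := isCompact_uIcc.exists_bound_of_continuousOn hg
  have hgC : MemLp g ⊤ (volume.restrict (uIoc a b)) :=
    memLp_top_of_bound ((hg.mono uIoc_subset_uIcc).aestronglyMeasurable measurableSet_uIoc) C <|
      ae_restrict_of_forall_mem measurableSet_uIoc fun t ht => hC t (uIoc_subset_uIcc ht)
  rw [intervalIntegrable_iff, IntegrableOn, ← memLp_one_iff_integrable] at hf ⊢
  exact M.memLp_of_bilin 1 hf hgC

theorem integral_inner_apply_primitive [CompleteSpace H] (hA : A.IsSymmetric) {g : ℝ → H}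
    {a b : ℝ} (hg : IntervalIntegrable g volume a b) (c : H) :
    2 * ∫ t in a..b, inner ℝ (A (g t)) (c + ∫ s in a..t, g s)
      = inner ℝ (A (c + ∫ s in a..b, g s)) (c + ∫ s in a..b, g s) - inner ℝ (A c) c := by
  set f : ℝ → H := fun t => c + ∫ s in a..t, g s
  have hf : AbsolutelyContinuousOnInterval f a b :=
    absolutelyContinuousOnInterval_const_add_primitive hg c
  have hquad : ContDiff ℝ 1 fun x => inner ℝ (A x) x := A.contDiff.inner ℝ contDiff_id
  have hderiv : ∀ᵐ t, t ∈ uIcc a b →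
      HasDerivAt (fun t => inner ℝ (A (f t)) (f t)) (2 * inner ℝ (A (g t)) (f t)) t := by
    filter_upwards [ae_hasDerivAt_primitive hg] with t h ht
    have hft : HasDerivAt f (g t) t := (h ht).const_add c
    have hsymm : inner ℝ (A (f t)) (g t) = inner ℝ (A (g t)) (f t) := by
      rw [real_inner_comm]
      exact (hA (g t) (f t)).symm
    simpa only [Function.comp_apply, hsymm, two_mul] using
      (A.hasFDerivAt.comp_hasDerivAt t hft).inner ℝ hft
  have hint : IntervalIntegrable (fun t => inner ℝ (A (g t)) (f t)) volume a b :=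
    intervalIntegrable_clm_apply₂ ((innerSL ℝ).comp A) hg hf.continuousOn
  rw [← intervalIntegral.integral_const_mul,
    integral_eq_sub_of_ae_hasDerivAt (absolutelyContinuousOnInterval_contDiff_comp hquad hf)
      (hint.const_mul 2) hderiv]
  simp [f]

section EnergyInequality

variable [CompleteSpace H] {a b : ℝ} {g : ℝ → H} {c : H} {α : ℝ → ℝ}

theorem inner_apply_primitive_eq_zero_of_le (hab : a ≤ b) (hA : A.IsPositive)
    (hg : IntervalIntegrable g volume a b) (hc : inner ℝ (A c) c = 0)
    (hα : IntervalIntegrable α volume a b) (hα0 : ∀ t, 0 ≤ α t)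
    (h : ∀ᵐ t ∂volume.restrict (Ioo a b), inner ℝ (A (g t)) (c + ∫ s in a..t, g s)
      ≤ α t * inner ℝ (A (c + ∫ s in a..t, g s)) (c + ∫ s in a..t, g s)) :
    ∀ t ∈ Icc a b, inner ℝ (A (c + ∫ s in a..t, g s)) (c + ∫ s in a..t, g s) = 0 := by
  set f : ℝ → H := fun t => c + ∫ s in a..t, g s
  have hu : uIcc a b = Icc a b := uIcc_of_le hab
  have hf : ContinuousOn f (Icc a b) :=
    hu ▸ (absolutelyContinuousOnInterval_const_add_primitive hg c).continuousOn
  have henergy : ContinuousOn (fun t => inner ℝ (A (f t)) (f t)) (Icc a b) := by fun_prop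
  have hAgf : IntervalIntegrable (fun t => inner ℝ (A (g t)) (f t)) volume a b :=
    intervalIntegrable_clm_apply₂ ((innerSL ℝ).comp A) hg (hu ▸ hf)
  have hα2 : IntervalIntegrable (fun t => 2 * α t) volume a b := hα.const_mul 2
  refine eq_zero_of_le_integral_mul hab henergy (fun t _ => hA.inner_nonneg_left _) hα2
    (fun t => mul_nonneg zero_le_two (hα0 t)) fun t ht => ?_
  have hsub : uIcc a t ⊆ uIcc a b := uIcc_subset_uIcc left_mem_uIcc (hu ▸ ht)
  have identity := integral_inner_apply_primitive hA.isSymmetric (hg.mono_set hsub) c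
  rw [hc, sub_zero, ← intervalIntegral.integral_const_mul] at identity
  rw [← identity]
  refine intervalIntegral.integral_mono_ae_restrict ht.1 ((hAgf.mono_set hsub).const_mul 2)
    ((hα2.mul_continuousOn (hu ▸ henergy)).mono_set hsub) ?_
  rw [← restrict_Ioo_eq_restrict_Icc]
  filter_upwards [ae_restrict_of_ae_restrict_of_subset (Ioo_subset_Ioo_right ht.2) h] with s hs
  linarith

theorem ae_eq_zero_of_add_inner_apply_primitive_le (hab : a ≤ b) (hA : A.IsPositive)
    (hg : IntervalIntegrable g volume a b) (hc : inner ℝ (A c) c = 0)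
    (hα : IntervalIntegrable α volume a b) (hα0 : ∀ t, 0 ≤ α t) {D : ℝ → ℝ}
    (hD : IntervalIntegrable D volume a b) (hD0 : ∀ t, 0 ≤ D t)
    (h : ∀ᵐ t ∂volume.restrict (Ioo a b), D t + inner ℝ (A (g t)) (c + ∫ s in a..t, g s)
      ≤ α t * inner ℝ (A (c + ∫ s in a..t, g s)) (c + ∫ s in a..t, g s)) :
    ∀ᵐ t ∂volume.restrict (Ioo a b), D t = 0 := by
  have henergy := inner_apply_primitive_eq_zero_of_le hab hA hg hc hα hα0 <|
    h.mono fun t ht => (le_add_of_nonneg_left (hD0 t)).trans ht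
  set f : ℝ → H := fun t => c + ∫ s in a..t, g s
  have hAgf : IntervalIntegrable (fun t => inner ℝ (A (g t)) (f t)) volume a b :=
    intervalIntegrable_clm_apply₂ ((innerSL ℝ).comp A) hg
      (absolutelyContinuousOnInterval_const_add_primitive hg c).continuousOn
  have hAgf0 : ∫ t in a..b, inner ℝ (A (g t)) (f t) = 0 := by
    have identity := integral_inner_apply_primitive hA.isSymmetric hg c
    rw [hc, henergy b (right_mem_Icc.2 hab), sub_zero] at identity
    exact (mul_eq_zero.1 identity).resolve_left two_ne_zero
  have hDle : ∫ t in a..b, D t ≤ ∫ t in a..b, -inner ℝ (A (g t)) (f t) := by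
    refine intervalIntegral.integral_mono_ae_restrict hab hD hAgf.neg ?_
    rw [← restrict_Ioo_eq_restrict_Icc]
    filter_upwards [h, ae_restrict_mem measurableSet_Ioo] with t ht htmem
    rw [henergy t (Ioo_subset_Icc_self htmem), mul_zero] at ht
    linarith
  rw [intervalIntegral.integral_neg, hAgf0, neg_zero, intervalIntegral.integral_of_le hab,
    integral_Ioc_eq_integral_Ioo] at hDle
  exact (integral_eq_zero_iff_of_nonneg hD0
    ((intervalIntegrable_iff_integrableOn_Ioo_of_le hab).1 hD)).1
    (le_antisymm hDle (integral_nonneg hD0))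

end EnergyInequality

end Energy

/-! ### Weak time derivatives -/

/-- Test functions on `U`: `φ ∈ C_c^∞(U)`. -/
structure IsTestFunction {E : Type*} [NormedAddCommGroup E] [NormedSpace ℝ E] (U : Set E)
    (φ : E → ℝ) : Prop where
  contDiff : ContDiff ℝ ∞ φ
  hasCompactSupport : HasCompactSupport φ
  tsupport_subset : tsupport φ ⊆ U

namespace IsTestFunction

variable {E : Type*} [NormedAddCommGroup E] [NormedSpace ℝ E] {U : Set E} {φ ψ : E → ℝ}

theorem eq_zero_of_notMem (hφ : IsTestFunction U φ) {x : E} (hx : x ∉ U) : φ x = 0 :=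
  image_eq_zero_of_notMem_tsupport fun h => hx (hφ.tsupport_subset h)

theorem sub (hφ : IsTestFunction U φ) (hψ : IsTestFunction U ψ) :
    IsTestFunction U (fun x => φ x - ψ x) where
  contDiff := hφ.contDiff.sub hψ.contDiff
  hasCompactSupport := hφ.hasCompactSupport.sub hψ.hasCompactSupport
  tsupport_subset :=
    (tsupport_sub φ ψ).trans (union_subset hφ.tsupport_subset hψ.tsupport_subset)

theorem const_mul (hφ : IsTestFunction U φ) (c : ℝ) : IsTestFunction U (fun x => c * φ x) where
  contDiff := contDiff_const.mul hφ.contDiff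
  hasCompactSupport := hφ.hasCompactSupport.mul_left
  tsupport_subset := (tsupport_mul_subset_right (f := fun _ => c)).trans hφ.tsupport_subset

theorem fderiv_apply (hφ : IsTestFunction U φ) (v : E) :
    IsTestFunction U (fun x => fderiv ℝ φ x v) where
  contDiff := (hφ.contDiff.fderiv_right (m := ∞) (by simp)).clm_apply contDiff_const
  hasCompactSupport := hφ.hasCompactSupport.fderiv_apply ℝ v
  tsupport_subset := (tsupport_fderiv_apply_subset ℝ v).trans hφ.tsupport_subset

theorem deriv {I : Set ℝ} {φ : ℝ → ℝ} (hφ : IsTestFunction I φ) : IsTestFunction I (deriv φ) :=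
  hφ.fderiv_apply 1

theorem integrable_smul [MeasurableSpace E] [OpensMeasurableSpace E] {X : Type*}
    [NormedAddCommGroup X] [NormedSpace ℝ X] {μ : Measure E} {f : E → X}
    (hφ : IsTestFunction U φ) (hf : Integrable f μ) : Integrable (fun x => φ x • f x) μ := by
  obtain ⟨C, hC⟩ := hφ.contDiff.continuous.bounded_above_of_compact_support hφ.hasCompactSupport
  exact hf.bdd_smul C hφ.contDiff.continuous.aestronglyMeasurable
    (ae_of_all _ hC)

end IsTestFunction

section WeakTimeDeriv

variable {X Y : Type*} [NormedAddCommGroup X] [NormedSpace ℝ X] [NormedAddCommGroup Y]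
  [NormedSpace ℝ Y] {T : ℝ} {f f₁ g g₁ : ℝ → X}

theorem MemL2Time.integrable {X : Type*} [NormedAddCommGroup X] {f : ℝ → X}
    (hf : MemL2Time T f) : Integrable f (timeMeasure T) :=
  MemLp.integrable one_le_two hf

theorem integrable_timeMeasure_iff {X : Type*} [NormedAddCommGroup X] {f : ℝ → X} (hT : 0 ≤ T) :
    Integrable f (timeMeasure T) ↔ IntervalIntegrable f volume 0 T :=
  (intervalIntegrable_iff_integrableOn_Ioo_of_le hT).symm

theorem integral_timeMeasure_eq (hT : 0 ≤ T) (f : ℝ → X) :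
    ∫ t, f t ∂timeMeasure T = ∫ t in 0..T, f t := by
  rw [intervalIntegral.integral_of_le hT, integral_Ioc_eq_integral_Ioo]

theorem ae_eq_zero_of_forall_integral_smul_eq_zero [CompleteSpace X]
    (hf : Integrable f (timeMeasure T))
    (h : ∀ φ, IsTestFunction (Ioo 0 T) φ → ∫ t, φ t • f t ∂timeMeasure T = 0) :
    ∀ᵐ t ∂timeMeasure T, f t = 0 := by
  rw [ae_restrict_iff' measurableSet_Ioo]
  refine isOpen_Ioo.ae_eq_zero_of_integral_contDiff_smul_eq_zero
    (IntegrableOn.locallyIntegrableOn hf) fun φ hsmooth hcompact hsupp => ?_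
  have hφ : IsTestFunction (Ioo 0 T) φ := ⟨hsmooth, hcompact, hsupp⟩
  rw [← h φ hφ, setIntegral_eq_integral_of_forall_compl_eq_zero]
  exact fun t ht => by rw [hφ.eq_zero_of_notMem ht, zero_smul]

namespace HasWeakTimeDeriv

theorem integral_deriv_smul (h : HasWeakTimeDeriv T f g) {φ : ℝ → ℝ}
    (hφ : IsTestFunction (Ioo 0 T) φ) :
    ∫ t, deriv φ t • f t ∂timeMeasure T = -∫ t, φ t • g t ∂timeMeasure T :=
  h φ hφ.contDiff hφ.hasCompactSupport hφ.tsupport_subset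

theorem congr (h : HasWeakTimeDeriv T f g) (hf : f =ᵐ[timeMeasure T] f₁) :
    HasWeakTimeDeriv T f₁ g := by
  intro φ h₁ h₂ h₃
  rw [← h φ h₁ h₂ h₃]
  exact integral_congr_ae <| hf.mono fun t ht => by simp only [ht]

theorem sub (h : HasWeakTimeDeriv T f g) (h₁ : HasWeakTimeDeriv T f₁ g₁)
    (hf : Integrable f (timeMeasure T)) (hf₁ : Integrable f₁ (timeMeasure T))
    (hg : Integrable g (timeMeasure T)) (hg₁ : Integrable g₁ (timeMeasure T)) :
    HasWeakTimeDeriv T (fun t => f t - f₁ t) (fun t => g t - g₁ t) := by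
  intro φ hsmooth hcompact hsupp
  have hφ : IsTestFunction (Ioo 0 T) φ := ⟨hsmooth, hcompact, hsupp⟩
  simp only [smul_sub]
  rw [integral_sub (hφ.deriv.integrable_smul hf) (hφ.deriv.integrable_smul hf₁),
    integral_sub (hφ.integrable_smul hg) (hφ.integrable_smul hg₁), h.integral_deriv_smul hφ,
    h₁.integral_deriv_smul hφ, neg_sub_neg, neg_sub]

theorem clm_comp [CompleteSpace X] [CompleteSpace Y] (L : X →L[ℝ] Y) (h : HasWeakTimeDeriv T f g)
    (hf : Integrable f (timeMeasure T)) (hg : Integrable g (timeMeasure T)) :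
    HasWeakTimeDeriv T (fun t => L (f t)) (fun t => L (g t)) := by
  intro φ hsmooth hcompact hsupp
  have hφ : IsTestFunction (Ioo 0 T) φ := ⟨hsmooth, hcompact, hsupp⟩
  simp only [← map_smul]
  rw [L.integral_comp_comm (hφ.deriv.integrable_smul hf),
    L.integral_comp_comm (hφ.integrable_smul hg), h.integral_deriv_smul hφ, map_neg]

theorem ae_eq [CompleteSpace X] (h : HasWeakTimeDeriv T f g) (h₁ : HasWeakTimeDeriv T f g₁)
    (hg : Integrable g (timeMeasure T)) (hg₁ : Integrable g₁ (timeMeasure T)) :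
    g =ᵐ[timeMeasure T] g₁ := by
  have hsub : ∀ᵐ t ∂timeMeasure T, (g - g₁) t = 0 := by
    refine ae_eq_zero_of_forall_integral_smul_eq_zero (hg.sub hg₁) fun φ hφ => ?_
    simp only [Pi.sub_apply, smul_sub]
    rw [integral_sub (hφ.integrable_smul hg) (hφ.integrable_smul hg₁), sub_eq_zero, ← neg_inj,
      ← h.integral_deriv_smul hφ, h₁.integral_deriv_smul hφ]
  exact hsub.mono fun t ht => sub_eq_zero.1 ht

end HasWeakTimeDeriv

theorem hasWeakTimeDeriv_primitive [CompleteSpace X] (hT : 0 ≤ T)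
    (hg : Integrable g (timeMeasure T)) : HasWeakTimeDeriv T (fun t => ∫ s in 0..t, g s) g := by
  intro φ hsmooth hcompact hsupp
  have hφ : IsTestFunction (Ioo 0 T) φ := ⟨hsmooth, hcompact, hsupp⟩
  rw [integrable_timeMeasure_iff hT] at hg
  have hG := absolutelyContinuousOnInterval_primitive hg
  have hφG : AbsolutelyContinuousOnInterval (fun t => φ t • ∫ s in 0..t, g s) 0 T :=
    (hsmooth.of_le (by simp)).contDiffOn.absolutelyContinuousOnInterval.fun_smul hG
  have hderiv : ∀ᵐ t, t ∈ uIcc 0 T → HasDerivAt (fun t => φ t • ∫ s in 0..t, g s)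
      (φ t • g t + deriv φ t • ∫ s in 0..t, g s) t := by
    filter_upwards [ae_hasDerivAt_primitive hg] with t ht htmem
    exact (hsmooth.differentiable (by simp) t).hasDerivAt.smul (ht htmem)
  have hi : IntervalIntegrable (fun t => φ t • g t) volume 0 T :=
    hg.continuousOn_smul hsmooth.continuous.continuousOn
  have hi' : IntervalIntegrable (fun t => deriv φ t • ∫ s in 0..t, g s) volume 0 T :=
    (hφ.deriv.contDiff.continuous.continuousOn.smul hG.continuousOn).intervalIntegrable
  have parts := integral_eq_sub_of_ae_hasDerivAt hφG (hi.add hi') hderiv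
  rw [intervalIntegral.integral_add hi hi', hφ.eq_zero_of_notMem (by simp),
    hφ.eq_zero_of_notMem (by simp), zero_smul, zero_smul, sub_zero] at parts
  rw [integral_timeMeasure_eq hT, integral_timeMeasure_eq hT]
  exact eq_neg_of_add_eq_zero_right parts

theorem exists_subset_Icc_of_isCompact_of_subset_Ioo {a b : ℝ} (hab : a < b) {K : Set ℝ}
    (hK : IsCompact K) (hKab : K ⊆ Ioo a b) :
    ∃ c d, a < c ∧ d < b ∧ K ⊆ Icc c d := by
  rcases K.eq_empty_or_nonempty with rfl | hne
  · obtain ⟨c, hac, hcb⟩ := exists_between hab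
    exact ⟨c, c, hac, hcb, empty_subset _⟩
  · obtain ⟨c, hc, hmin⟩ := hK.exists_isLeast hne
    obtain ⟨d, hd, hmax⟩ := hK.exists_isGreatest hne
    exact ⟨c, d, (hKab hc).1, (hKab hd).2, fun x hx => ⟨hmin hx, hmax hx⟩⟩

theorem IsTestFunction.exists_deriv_eq {a b : ℝ} (hab : a < b) {θ : ℝ → ℝ}
    (hθ : IsTestFunction (Ioo a b) θ) (hint : ∫ t in a..b, θ t = 0) :
    ∃ φ, IsTestFunction (Ioo a b) φ ∧ _root_.deriv φ = θ := by
  obtain ⟨c, d, hac, hdb, hsupp⟩ :=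
    exists_subset_Icc_of_isCompact_of_subset_Ioo hab hθ.hasCompactSupport hθ.tsupport_subset
  have hθ0 : ∀ t ∉ Icc c d, θ t = 0 := fun t ht =>
    image_eq_zero_of_notMem_tsupport fun h => ht (hsupp h)
  have hθi : ∀ s t, IntervalIntegrable θ volume s t := fun s t =>
    hθ.contDiff.continuous.intervalIntegrable s t
  set φ : ℝ → ℝ := fun t => ∫ s in a..t, θ s
  have hderiv : ∀ t, HasDerivAt φ (θ t) t :=
    fun t => hθ.contDiff.continuous.integral_hasStrictDerivAt a t |>.hasDerivAt
  have hφsupp : tsupport φ ⊆ Icc c d := by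
    refine closure_minimal (fun t ht => ?_) isClosed_Icc
    by_contra hcon
    refine ht ?_
    rw [mem_Icc, not_and_or, not_le, not_le] at hcon
    rcases hcon with htc | hdt
    · refine intervalIntegral.integral_zero_ae (ae_of_all _ fun s hs => hθ0 s fun hs' => ?_)
      rcases mem_uIoc.1 hs with h | h <;> linarith [hs'.1, h.2]
    · have hright : ∫ s in t..b, θ s = 0 := by
        refine intervalIntegral.integral_zero_ae (ae_of_all _ fun s hs => hθ0 s fun hs' => ?_)
        rcases mem_uIoc.1 hs with h | h <;> linarith [hs'.2, h.1]
      have hadd := intervalIntegral.integral_add_adjacent_intervals (hθi a t) (hθi t b)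
      rwa [hright, hint, add_zero] at hadd
  have hφ' : _root_.deriv φ = θ := funext fun t => (hderiv t).deriv
  refine ⟨φ, ⟨?_, ?_, ?_⟩, hφ'⟩
  · rw [contDiff_infty_iff_deriv, hφ']
    exact ⟨fun t => (hderiv t).differentiableAt, hθ.contDiff⟩
  · exact isCompact_Icc.of_isClosed_subset (isClosed_tsupport _) hφsupp
  · exact hφsupp.trans (Icc_subset_Ioo hac hdb)

theorem exists_isTestFunction_integral_eq_one (hT : 0 < T) :
    ∃ ρ, IsTestFunction (Ioo 0 T) ρ ∧ ∫ t in 0..T, ρ t = 1 := by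
  let B : ContDiffBump (T / 2) := ⟨T / 8, T / 4, by positivity, by linarith⟩
  have hsupp : tsupport (B.normed volume) ⊆ Ioo 0 T := by
    rw [B.tsupport_normed_eq, Real.closedBall_eq_Icc]
    exact Icc_subset_Ioo (by simp only [B]; linarith) (by simp only [B]; linarith)
  have hρ : IsTestFunction (Ioo 0 T) (B.normed volume) :=
    ⟨B.contDiff_normed, B.hasCompactSupport_normed, hsupp⟩
  refine ⟨B.normed volume, hρ, ?_⟩
  rw [← integral_timeMeasure_eq hT.le, setIntegral_eq_integral_of_forall_compl_eq_zero fun t ht =>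
    hρ.eq_zero_of_notMem ht, B.integral_normed]

theorem HasWeakTimeDeriv.exists_ae_eq_const [CompleteSpace X] (hT : 0 < T)
    (hf : Integrable f (timeMeasure T)) (h : HasWeakTimeDeriv T f 0) :
    ∃ c, ∀ᵐ t ∂timeMeasure T, f t = c := by
  obtain ⟨ρ, hρ, hρ1⟩ := exists_isTestFunction_integral_eq_one hT
  set c := ∫ t, ρ t • f t ∂timeMeasure T
  have hsub : ∀ᵐ t ∂timeMeasure T, f t - c = 0 := by
    refine ae_eq_zero_of_forall_integral_smul_eq_zero (hf.sub (integrable_const c)) fun ψ hψ => ?_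
    set I := ∫ t in 0..T, ψ t
    -- `ψ - (∫ ψ) ρ` has zero integral, hence is the derivative of a test function.
    have hmean : ∫ t in 0..T, (ψ t - I * ρ t) = 0 := by
      rw [intervalIntegral.integral_sub (hψ.contDiff.continuous.intervalIntegrable _ _)
        ((hρ.const_mul I).contDiff.continuous.intervalIntegrable _ _),
        intervalIntegral.integral_const_mul, hρ1, mul_one, sub_self]
    obtain ⟨φ, hφ, hφ'⟩ := (hψ.sub (hρ.const_mul I)).exists_deriv_eq hT hmean
    have hφf := h.integral_deriv_smul hφ
    simp only [hφ', Pi.zero_apply, smul_zero, integral_zero, neg_zero, sub_smul, mul_smul] at hφf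
    rw [integral_sub (hψ.integrable_smul hf) ((hρ.integrable_smul hf).fun_smul I),
      integral_smul] at hφf
    simp only [smul_sub]
    rwa [integral_sub (hψ.integrable_smul hf) (hψ.integrable_smul (integrable_const c)),
      integral_smul_const, integral_timeMeasure_eq hT.le ψ]
  exact ⟨c, hsub.mono fun t ht => sub_eq_zero.1 ht⟩

theorem HasWeakTimeDeriv.exists_ae_eq_primitive [CompleteSpace X] (hT : 0 < T)
    (hf : Integrable f (timeMeasure T)) (hg : Integrable g (timeMeasure T))
    (h : HasWeakTimeDeriv T f g) :
    ∃ c, ∀ᵐ t ∂timeMeasure T, f t = c + ∫ s in 0..t, g s := by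
  have hG : Integrable (fun t => ∫ s in 0..t, g s) (timeMeasure T) :=
    (integrable_timeMeasure_iff hT.le).2 (absolutelyContinuousOnInterval_primitive
      ((integrable_timeMeasure_iff hT.le).1 hg)).continuousOn.intervalIntegrable
  have hsub := h.sub (hasWeakTimeDeriv_primitive hT.le hg) hf hG hg hg
  simp only [sub_self] at hsub
  obtain ⟨c, hc⟩ := HasWeakTimeDeriv.exists_ae_eq_const hT (hf.sub hG) hsub
  exact ⟨c, hc.mono fun t ht => sub_eq_iff_eq_add.1 ht⟩

end WeakTimeDeriv

theorem ae_apply_eq_zero_of_forall_integral_eq_zero {α X : Type*} [MeasurableSpace α]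
    [NormedAddCommGroup X] {μ : Measure α} {r : ℝ≥0∞} {B : α → X → ℝ} (hB0 : ∀ t, B t 0 = 0)
    (hB : ∀ w, MemLp w r μ → Integrable (fun t => B t (w t)) μ)
    (h : ∀ w, MemLp w r μ → ∫ t, B t (w t) ∂μ = 0) {w : α → X} (hw : MemLp w r μ) :
    ∀ᵐ t ∂μ, B t (w t) = 0 := by
  refine (hB w hw).ae_eq_zero_of_forall_setIntegral_eq_zero fun s hs _ => ?_
  rw [← integral_indicator hs, ← h _ (hw.indicator hs)]
  refine integral_congr_ae (ae_of_all _ fun t => ?_)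
  by_cases ht : t ∈ s <;> simp [ht, hB0]

/-! ### The space `H¹₀(Ω)` -/

section TestFunctions

variable {E : Type*} [NormedAddCommGroup E] [NormedSpace ℝ E]

theorem fderiv_fderiv_apply_comm {φ : E → ℝ} (hφ : ContDiff ℝ 2 φ) (v w x : E) :
    fderiv ℝ (fun y => fderiv ℝ φ y v) x w = fderiv ℝ (fun y => fderiv ℝ φ y w) x v := by
  have hdiff : DifferentiableAt ℝ (fderiv ℝ φ) x :=
    (hφ.fderiv_right (m := 1) (by norm_num)).differentiable (by simp) x
  have second : ∀ v w,
      fderiv ℝ (fun y => fderiv ℝ φ y v) x w = fderiv ℝ (fderiv ℝ φ) x w v := fun v w => by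
    rw [fderiv_clm_apply hdiff (differentiableAt_const v)]
    simp
  rw [second, second, hφ.contDiffAt.isSymmSndFDerivAt (by simp) v w]

theorem integral_fderiv_mul_fderiv_comm [FiniteDimensional ℝ E] [MeasurableSpace E] [BorelSpace E]
    (μ : Measure E) [μ.IsAddHaarMeasure] {φ ψ : E → ℝ} (hφ : ContDiff ℝ 2 φ)
    (hψ : ContDiff ℝ 1 ψ) (hψc : HasCompactSupport ψ) (v w : E) :
    ∫ x, fderiv ℝ φ x v * fderiv ℝ ψ x w ∂μ = ∫ x, fderiv ℝ φ x w * fderiv ℝ ψ x v ∂μ := by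
  have hφ' : ∀ v, ContDiff ℝ 1 fun x => fderiv ℝ φ x v := fun v =>
    (hφ.fderiv_right (m := 1) (by norm_num)).clm_apply contDiff_const
  have hφ'' : ∀ v w, Continuous fun x => fderiv ℝ (fun y => fderiv ℝ φ y v) x w := fun v w =>
    ((hφ' v).continuous_fderiv one_ne_zero).clm_apply continuous_const
  have hψ' : ∀ v, Continuous fun x => fderiv ℝ ψ x v := fun v =>
    (hψ.continuous_fderiv one_ne_zero).clm_apply continuous_const
  have integrable : ∀ {f g : E → ℝ}, Continuous f → Continuous g → HasCompactSupport g →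
      Integrable (fun x => f x * g x) μ := fun hf hg hgc =>
    (hf.mul hg).integrable_of_hasCompactSupport hgc.mul_left
  have parts : ∀ v w, ∫ x, fderiv ℝ φ x v * fderiv ℝ ψ x w ∂μ
      = -∫ x, fderiv ℝ (fun y => fderiv ℝ φ y v) x w * ψ x ∂μ := fun v w =>
    integral_mul_fderiv_eq_neg_fderiv_mul_of_integrable
      (integrable (hφ'' v w) hψ.continuous hψc)
      (integrable (hφ' v).continuous (hψ' w) (hψc.fderiv_apply ℝ w))
      (integrable (hφ' v).continuous hψ.continuous hψc)
      (fun x _ => (hφ' v).differentiable one_ne_zero x)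
      (fun x _ => hψ.differentiable one_ne_zero x)
  rw [parts v w, parts w v]
  simp only [fderiv_fderiv_apply_comm hφ v w]

theorem norm_le_sum_norm_apply_orthonormalBasis {ι F : Type*} [Fintype ι] {H : Type*}
    [NormedAddCommGroup H] [InnerProductSpace ℝ H] [NormedAddCommGroup F] [NormedSpace ℝ F]
    (b : OrthonormalBasis ι ℝ H) (L : H →L[ℝ] F) : ‖L‖ ≤ ∑ i, ‖L (b i)‖ := by
  refine L.opNorm_le_bound (Finset.sum_nonneg fun i _ => norm_nonneg _) fun x => ?_
  calc ‖L x‖ = ‖∑ i, inner ℝ (b i) x • L (b i)‖ := by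
        conv_lhs => rw [← b.sum_repr' x, map_sum]
        simp only [map_smul]
    _ ≤ ∑ i, ‖L (b i)‖ * ‖x‖ := norm_sum_le_of_le _ fun i _ => by
        rw [norm_smul, mul_comm]
        gcongr
        simpa using norm_inner_le_norm (𝕜 := ℝ) (b i) x
    _ = (∑ i, ‖L (b i)‖) * ‖x‖ := (Finset.sum_mul _ _ _).symm

end TestFunctions

theorem exists_eLpNorm_le_sum_eLpNorm_fderiv {Ω : Set E3} (hΩ : Bornology.IsBounded Ω) :
    ∃ C : ℝ≥0, ∀ φ, IsTestFunction Ω φ → eLpNorm φ 2 (volume.restrict Ω)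
      ≤ C * ∑ i : Fin 3, eLpNorm (fun x => fderiv ℝ φ x (EuclideanSpace.single i 1)) 2
          (volume.restrict Ω) := by
  refine ⟨eLpNormLESNormFDerivOfLeConst ℝ volume Ω 2 2, fun φ hφ => ?_⟩
  have hsupp : Function.support φ ⊆ Ω := (subset_tsupport φ).trans hφ.tsupport_subset
  have hsupp' : Function.support (fderiv ℝ φ) ⊆ Ω :=
    (support_fderiv_subset ℝ).trans hφ.tsupport_subset
  have sobolev := eLpNorm_le_eLpNorm_fderiv volume (p := 2)
    (hφ.contDiff.of_le (by simp)) hsupp one_le_two (by simp; norm_num) hΩ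
  rw [← eLpNorm_restrict_eq_of_support_subset hsupp,
    ← eLpNorm_restrict_eq_of_support_subset (f := fderiv ℝ φ) hsupp'] at sobolev
  refine sobolev.trans (mul_le_mul_right ?_ _)
  have hcont : ∀ i, Continuous fun x => ‖fderiv ℝ φ x (EuclideanSpace.single i 1)‖ := fun i =>
    (hφ.fderiv_apply _).contDiff.continuous.norm
  calc eLpNorm (fderiv ℝ φ) 2 (volume.restrict Ω)
      ≤ eLpNorm (∑ i : Fin 3, fun x => ‖fderiv ℝ φ x (EuclideanSpace.single i 1)‖) 2
          (volume.restrict Ω) := by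
        refine eLpNorm_mono_real fun x => ?_
        simpa using norm_le_sum_norm_apply_orthonormalBasis (EuclideanSpace.basisFun (Fin 3) ℝ)
          (fderiv ℝ φ x)
    _ ≤ ∑ i : Fin 3, eLpNorm (fun x => ‖fderiv ℝ φ x (EuclideanSpace.single i 1)‖) 2
          (volume.restrict Ω) :=
        eLpNorm_sum_le (fun i _ => (hcont i).aestronglyMeasurable) one_le_two
    _ = _ := by simp only [eLpNorm_norm]

section Sobolev

variable {Ω : Set E3}

/-- The element `f` of `H¹₀(Ω)` is the class of the test function `φ`. -/
structure IsRepr (f : H10 Ω) (φ : E3 → ℝ) : Prop where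
  isTestFunction : IsTestFunction Ω φ
  val_ae_eq : val Ω f =ᵐ[volume.restrict Ω] φ
  pd_ae_eq : ∀ i : Fin 3, pd Ω i f =ᵐ[volume.restrict Ω]
    fun x => fderiv ℝ φ x (EuclideanSpace.single i 1)

theorem H10.induction_on {p : H10 Ω → Prop} (hp : IsClosed {f | p f})
    (h : ∀ f φ, IsRepr f φ → p f) (f : H10 Ω) : p f := by
  have hdense : DenseRange (inclusion (subset_closure
      (s := (testPairs Ω : Set (WithLp 2 (L2 Ω × L2Vec Ω)))))) :=
    (denseRange_inclusion_iff _).2 Subset.rfl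
  refine hdense.induction_on (p := p) f hp fun v => ?_
  obtain ⟨φ, hsmooth, hcompact, hsupp, hval, hpd⟩ := v.2
  exact h _ φ ⟨⟨hsmooth, hcompact, hsupp⟩, hval, hpd⟩

theorem inner_eq_integral {f g : L2 Ω} {φ ψ : E3 → ℝ} (hf : f =ᵐ[volume.restrict Ω] φ)
    (hg : g =ᵐ[volume.restrict Ω] ψ) (hψ : IsTestFunction Ω ψ) :
    inner ℝ f g = ∫ x, φ x * ψ x := by
  rw [L2.inner_def,
    ← setIntegral_eq_integral_of_forall_compl_eq_zero (s := Ω) (f := fun x => φ x * ψ x)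
      fun x hx => by rw [hψ.eq_zero_of_notMem hx, mul_zero]]
  refine integral_congr_ae ?_
  filter_upwards [hf, hg] with x hfx hgx
  simp [hfx, hgx, mul_comm]

theorem inner_pd_pd_comm (f g : H10 Ω) (i j : Fin 3) :
    inner ℝ (pd Ω i f) (pd Ω j g) = inner ℝ (pd Ω j f) (pd Ω i g) := by
  induction f using H10.induction_on with
  | hp => exact isClosed_eq (by fun_prop) (by fun_prop)
  | h f φ hf =>
    induction g using H10.induction_on with
    | hp => exact isClosed_eq (by fun_prop) (by fun_prop)
    | h g ψ hg =>
      have hψ := hg.isTestFunction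
      rw [inner_eq_integral (hf.pd_ae_eq i) (hg.pd_ae_eq j) (hψ.fderiv_apply _),
        inner_eq_integral (hf.pd_ae_eq j) (hg.pd_ae_eq i) (hψ.fderiv_apply _)]
      exact integral_fderiv_mul_fderiv_comm volume (contDiff_infty.1 hf.isTestFunction.contDiff 2)
        (hψ.contDiff.of_le (by simp)) hψ.hasCompactSupport _ _

theorem exists_norm_val_le_sum_norm_pd (hΩ : Bornology.IsBounded Ω) :
    ∃ C : ℝ≥0, ∀ f : H10 Ω, ‖val Ω f‖ ≤ C * ∑ i, ‖pd Ω i f‖ := by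
  obtain ⟨C, hC⟩ := exists_eLpNorm_le_sum_eLpNorm_fderiv hΩ
  refine ⟨C, fun f => ?_⟩
  induction f using H10.induction_on with
  | hp => exact isClosed_le (by fun_prop) (by fun_prop)
  | h f φ hf =>
    have hφ := hC φ hf.isTestFunction
    simp only [← eLpNorm_congr_ae hf.val_ae_eq, ← eLpNorm_congr_ae (hf.pd_ae_eq _),
      ← Lp.enorm_def, enorm_eq_nnnorm] at hφ
    exact_mod_cast hφ

theorem H10.norm_sq_eq (f : H10 Ω) : ‖f‖ ^ 2 = ‖val Ω f‖ ^ 2 + ∑ i, ‖pd Ω i f‖ ^ 2 := by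
  have hgraph : ‖f‖ = ‖graph Ω f‖ := rfl
  rw [hgraph, WithLp.prod_norm_sq_eq_of_L2, PiLp.norm_sq_eq_of_L2]
  rfl

theorem H10.exists_norm_sq_le (hΩ : Bornology.IsBounded Ω) :
    ∃ C : ℝ, 0 < C ∧ ∀ f : H10 Ω, ‖f‖ ^ 2 ≤ C * ∑ i, ‖pd Ω i f‖ ^ 2 := by
  obtain ⟨C, hC⟩ := exists_norm_val_le_sum_norm_pd hΩ
  refine ⟨C ^ 2 * 3 + 1, by positivity, fun f => ?_⟩
  have cauchySchwarz : (∑ i, ‖pd Ω i f‖) ^ 2 ≤ 3 * ∑ i, ‖pd Ω i f‖ ^ 2 := by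
    simpa using sq_sum_le_card_mul_sum_sq (s := Finset.univ) (f := fun i => ‖pd Ω i f‖)
  calc ‖f‖ ^ 2 = ‖val Ω f‖ ^ 2 + ∑ i, ‖pd Ω i f‖ ^ 2 := H10.norm_sq_eq f
    _ ≤ (C * ∑ i, ‖pd Ω i f‖) ^ 2 + ∑ i, ‖pd Ω i f‖ ^ 2 := by gcongr; exact hC f
    _ ≤ C ^ 2 * (3 * ∑ i, ‖pd Ω i f‖ ^ 2) + ∑ i, ‖pd Ω i f‖ ^ 2 := by rw [mul_pow]; gcongr
    _ = _ := by ring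

end Sobolev

/-! ### Elasticity -/

section Elasticity

variable {Ω : Set E3}

/-- The elasticity form `e` as a bounded bilinear map. -/
def elastL (Ω : Set E3) : H10Vec Ω →L[ℝ] H10Vec Ω →L[ℝ] ℝ :=
  (innerSL ℝ).bilinearComp (dvg Ω) (dvg Ω)
    + ∑ i : Fin 3, ∑ j : Fin 3, (innerSL ℝ).bilinearComp ((pd Ω j).comp (comp Ω i))
        ((pd Ω j).comp (comp Ω i))
    + ∑ i : Fin 3, ∑ j : Fin 3, (innerSL ℝ).bilinearComp ((pd Ω j).comp (comp Ω i))
        ((pd Ω i).comp (comp Ω j))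

theorem elastL_apply (u w : H10Vec Ω) : elastL Ω u w = elast u w := by
  simp [elastL, elast, comp]

theorem dvg_apply (u : H10Vec Ω) : dvg Ω u = ∑ i, pd Ω i (u i) := by
  simp [dvg, comp]

theorem elast_comm (u w : H10Vec Ω) : elast u w = elast w u := by
  unfold elast
  congr 1
  · simp only [real_inner_comm]
  · rw [Finset.sum_comm]
    simp only [real_inner_comm]

theorem sum_inner_pd_pd_eq_norm_dvg_sq (u : H10Vec Ω) :
    ∑ i : Fin 3, ∑ j : Fin 3, inner ℝ (pd Ω j (u i)) (pd Ω i (u j)) = ‖dvg Ω u‖ ^ 2 := by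
  rw [← real_inner_self_eq_norm_sq, dvg_apply, sum_inner]
  simp only [inner_sum]
  exact Finset.sum_congr rfl fun i _ => Finset.sum_congr rfl fun j _ => inner_pd_pd_comm _ _ _ _

theorem elast_self (u : H10Vec Ω) :
    elast u u = 2 * ‖dvg Ω u‖ ^ 2 + ∑ i : Fin 3, ∑ j : Fin 3, ‖pd Ω j (u i)‖ ^ 2 := by
  simp only [elast, sum_inner_pd_pd_eq_norm_dvg_sq, real_inner_self_eq_norm_sq]
  ring

theorem elastL_isCoercive (hΩ : Bornology.IsBounded Ω) : IsCoercive (elastL Ω) := by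
  obtain ⟨C, hC, h⟩ := H10.exists_norm_sq_le hΩ
  refine ⟨C⁻¹, by positivity, fun u => ?_⟩
  rw [elastL_apply, elast_self, mul_assoc, inv_mul_le_iff₀ hC, ← sq, PiLp.norm_sq_eq_of_L2]
  calc ∑ i, ‖u i‖ ^ 2 ≤ ∑ i, C * ∑ j, ‖pd Ω j (u i)‖ ^ 2 := Finset.sum_le_sum fun i _ => h (u i)
    _ = C * ∑ i, ∑ j, ‖pd Ω j (u i)‖ ^ 2 := (Finset.mul_sum _ _ _).symm
    _ ≤ C * (2 * ‖dvg Ω u‖ ^ 2 + ∑ i, ∑ j, ‖pd Ω j (u i)‖ ^ 2) := by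
      gcongr
      exact le_add_of_nonneg_left (by positivity)

/-- The operator `L²(Ω) → 𝐕` sending a pressure `f` to the displacement `u` it causes, that is,
the solution of `e(u, w) = (f, ∇·w)` for all `w ∈ 𝐕`. -/
def solveElast (hΩ : Bornology.IsBounded Ω) : L2 Ω →L[ℝ] H10Vec Ω :=
  ((elastL_isCoercive hΩ).continuousLinearEquivOfBilin.symm :
    H10Vec Ω →L[ℝ] H10Vec Ω).comp (ContinuousLinearMap.adjoint (dvg Ω))

theorem elast_solveElast (hΩ : Bornology.IsBounded Ω) (f : L2 Ω) (w : H10Vec Ω) :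
    elast (solveElast hΩ f) w = inner ℝ f (dvg Ω w) := by
  rw [← elastL_apply, ← (elastL_isCoercive hΩ).continuousLinearEquivOfBilin_apply]
  simp [solveElast, ContinuousLinearMap.adjoint_inner_left]

/-- The operator `f ↦ c₀ f + ∇·u` giving the fluid content, where `u` is the displacement caused
by the pressure `f`. -/
def storage (hΩ : Bornology.IsBounded Ω) (c₀ : ℝ) : L2 Ω →L[ℝ] L2 Ω :=
  c₀ • ContinuousLinearMap.id ℝ (L2 Ω) + (dvg Ω).comp (solveElast hΩ)

theorem storage_apply (hΩ : Bornology.IsBounded Ω) (c₀ : ℝ) (f : L2 Ω) :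
    storage hΩ c₀ f = c₀ • f + dvg Ω (solveElast hΩ f) := rfl

theorem inner_dvg_solveElast (hΩ : Bornology.IsBounded Ω) (f g : L2 Ω) :
    inner ℝ (dvg Ω (solveElast hΩ f)) g = elast (solveElast hΩ f) (solveElast hΩ g) := by
  rw [elast_comm, elast_solveElast, real_inner_comm]

theorem isPositive_storage (hΩ : Bornology.IsBounded Ω) {c₀ : ℝ} (hc₀ : 0 ≤ c₀) :
    (storage hΩ c₀).IsPositive := by
  refine (ContinuousLinearMap.isPositive_id.smul_of_nonneg hc₀).add
    ((ContinuousLinearMap.isPositive_iff _).2 ⟨fun f g => ?_, fun f => ?_⟩)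
  · simp only [ContinuousLinearMap.coe_coe, ContinuousLinearMap.comp_apply]
    rw [inner_dvg_solveElast, real_inner_comm, inner_dvg_solveElast, elast_comm]
  · rw [ContinuousLinearMap.comp_apply, inner_dvg_solveElast, elast_self]
    positivity

end Elasticity

/-! ### Weighted forms and the diffusion term -/

section WeightForm

variable {α : Type*} [MeasurableSpace α] {μ : Measure α} {k : ℝ → ℝ} {C : ℝ}

/-- The bilinear form `(k(z) a, b)` on `L²(μ)` whose weight is the coefficient `k` evaluated along
`z`; the diffusion form is a sum of three of these. -/
def weightForm (k : ℝ → ℝ) (z a b : Lp ℝ 2 μ) : ℝ :=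
  ∫ x, k (z x) * (a x * b x) ∂μ

theorem integrable_mul_Lp_two (a b : Lp ℝ 2 μ) : Integrable (fun x => a x * b x) μ :=
  (Lp.memLp a).integrable_mul (Lp.memLp b)

theorem integrable_weight_mul (hk : Continuous k) (hC : ∀ x, |k x| ≤ C) (z a b : Lp ℝ 2 μ) :
    Integrable (fun x => k (z x) * (a x * b x)) μ :=
  (integrable_mul_Lp_two a b).bdd_mul
    (hk.comp_aestronglyMeasurable (Lp.aestronglyMeasurable z)) (ae_of_all _ fun _ => hC _)

theorem norm_sq_eq_integral_sq (a : Lp ℝ 2 μ) : ‖a‖ ^ 2 = ∫ x, a x ^ 2 ∂μ := by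
  rw [← real_inner_self_eq_norm_sq, L2.inner_def]
  simp only [real_inner_self_eq_norm_sq, Real.norm_eq_abs, sq_abs]

theorem norm_weight_mul_le (hC : ∀ x, |k x| ≤ C) (z a b : ℝ) :
    ‖k z * (a * b)‖ ≤ C * |a * b| := by
  rw [norm_mul, Real.norm_eq_abs, Real.norm_eq_abs]
  exact mul_le_mul_of_nonneg_right (hC z) (abs_nonneg _)

theorem integral_abs_mul_le (a b : Lp ℝ 2 μ) : ∫ x, |a x * b x| ∂μ ≤ ‖a‖ * ‖b‖ := by
  have h : ∫ x, |a x * b x| ∂μ = inner ℝ |a| |b| := by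
    rw [L2.inner_def]
    refine integral_congr_ae ?_
    filter_upwards [Lp.coeFn_abs a, Lp.coeFn_abs b] with x ha hb
    rw [ha, hb, abs_mul, Real.inner_apply]
  rw [h]
  simpa only [norm_abs_eq_norm] using real_inner_le_norm |a| |b|

theorem abs_weightForm_le (hC : ∀ x, |k x| ≤ C) (z a b : Lp ℝ 2 μ) :
    |weightForm k z a b| ≤ C * (‖a‖ * ‖b‖) :=
  calc |weightForm k z a b| ≤ ∫ x, C * |a x * b x| ∂μ :=
        norm_integral_le_of_norm_le ((integrable_mul_Lp_two a b).abs.const_mul C)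
          (ae_of_all _ fun _ => norm_weight_mul_le hC _ _ _)
    _ = C * ∫ x, |a x * b x| ∂μ := integral_const_mul _ _
    _ ≤ C * (‖a‖ * ‖b‖) :=
        mul_le_mul_of_nonneg_left (integral_abs_mul_le a b) ((abs_nonneg _).trans (hC 0))

theorem weightForm_sub_weightForm (hk : Continuous k) (hC : ∀ x, |k x| ≤ C)
    (z a a' b b' : Lp ℝ 2 μ) :
    weightForm k z a' b' - weightForm k z a b
      = weightForm k z (a' - a) b' + weightForm k z a (b' - b) := by
  have hint := integrable_weight_mul (μ := μ) hk hC z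
  unfold weightForm
  rw [← integral_sub (hint _ _) (hint _ _), ← integral_add (hint _ _) (hint _ _)]
  refine integral_congr_ae ?_
  filter_upwards [Lp.coeFn_sub a' a, Lp.coeFn_sub b' b] with x ha hb
  rw [ha, hb, Pi.sub_apply, Pi.sub_apply]
  ring

theorem continuous_weightForm_left (hk : Continuous k) (hC : ∀ x, |k x| ≤ C) (a b : Lp ℝ 2 μ) :
    Continuous fun z => weightForm k z a b := by
  rw [continuous_iff_seqContinuous]
  intro z z₀ hz
  refine tendsto_of_subseq_tendsto fun n hn => ?_
  obtain ⟨m, -, hm⟩ := (tendstoInMeasure_of_tendsto_Lp (hz.comp hn)).exists_seq_tendsto_ae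
  refine ⟨m, tendsto_integral_of_dominated_convergence (fun x => C * |a x * b x|)
    (fun i => (integrable_weight_mul hk hC _ a b).1)
    ((integrable_mul_Lp_two a b).abs.const_mul C)
    (fun i => ae_of_all _ fun x => norm_weight_mul_le hC _ _ _) ?_⟩
  filter_upwards [hm] with x hx
  exact ((hk.tendsto _).comp hx).mul_const _

theorem continuous_weightForm (hk : Continuous k) (hC : ∀ x, |k x| ≤ C) :
    Continuous fun w : Lp ℝ 2 μ × Lp ℝ 2 μ × Lp ℝ 2 μ => weightForm k w.1 w.2.1 w.2.2 := by
  rw [continuous_iff_continuousAt]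
  rintro ⟨z, a, b⟩
  set bound : Lp ℝ 2 μ × Lp ℝ 2 μ × Lp ℝ 2 μ → ℝ := fun w =>
    C * (‖w.2.1 - a‖ * ‖w.2.2‖) + C * (‖a‖ * ‖w.2.2 - b‖)
      + |weightForm k w.1 a b - weightForm k z a b| with hbound
  have hbound_tendsto : Tendsto bound (𝓝 (z, a, b)) (𝓝 0) := by
    have hleft : Continuous fun w : Lp ℝ 2 μ × Lp ℝ 2 μ × Lp ℝ 2 μ => weightForm k w.1 a b :=
      (continuous_weightForm_left hk hC a b).comp continuous_fst
    have hcont : Continuous bound := by fun_prop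
    simpa [hbound] using hcont.tendsto (z, a, b)
  rw [ContinuousAt, tendsto_iff_norm_sub_tendsto_zero]
  refine squeeze_zero (fun _ => norm_nonneg _) (fun w => ?_) hbound_tendsto
  calc |weightForm k w.1 w.2.1 w.2.2 - weightForm k z a b|
      = |weightForm k w.1 (w.2.1 - a) w.2.2 + weightForm k w.1 a (w.2.2 - b)
          + (weightForm k w.1 a b - weightForm k z a b)| := by
        rw [← weightForm_sub_weightForm hk hC, sub_add_sub_cancel]
    _ ≤ |weightForm k w.1 (w.2.1 - a) w.2.2| + |weightForm k w.1 a (w.2.2 - b)|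
          + |weightForm k w.1 a b - weightForm k z a b| := abs_add_three _ _ _
    _ ≤ bound w :=
        add_le_add_left
          (add_le_add (abs_weightForm_le hC _ _ _) (abs_weightForm_le hC _ _ _)) _

variable {κ N : ℝ} {L : ℝ≥0}

theorem le_mul_sub_mul_of_lipschitzWith (hκ : 0 < κ) (hκk : ∀ x, κ ≤ k x)
    (hL : LipschitzWith L k) {a : ℝ} (ha : |a| ≤ N) (b z₁ z₂ : ℝ) :
    κ / 2 * (b - a) ^ 2 - L ^ 2 / (2 * κ) * N ^ 2 * (z₁ - z₂) ^ 2
      ≤ k z₁ * (b * (b - a)) - k z₂ * (a * (b - a)) := by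
  set s := (k z₁ - k z₂) * a with hs
  have hs_sq : s ^ 2 / (2 * κ) ≤ L ^ 2 / (2 * κ) * N ^ 2 * (z₁ - z₂) ^ 2 := by
    have hs_abs : |s| ≤ L * |z₁ - z₂| * N := by
      rw [hs, abs_mul]
      exact mul_le_mul (hL.dist_le_mul z₁ z₂) ha (abs_nonneg _) (by positivity)
    calc s ^ 2 / (2 * κ) ≤ (L * |z₁ - z₂| * N) ^ 2 / (2 * κ) := by
          rw [← sq_abs s]
          gcongr
      _ = L ^ 2 / (2 * κ) * N ^ 2 * (z₁ - z₂) ^ 2 := by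
          rw [mul_pow, mul_pow, sq_abs]
          ring
  have young : 0 ≤ κ / 2 * (b - a) ^ 2 + s * (b - a) + s ^ 2 / (2 * κ) := by
    have : κ / 2 * (b - a) ^ 2 + s * (b - a) + s ^ 2 / (2 * κ)
        = (κ * (b - a) + s) ^ 2 / (2 * κ) := by
      field_simp
      ring
    rw [this]
    positivity
  have hlower : κ * (b - a) ^ 2 ≤ k z₁ * (b - a) ^ 2 :=
    mul_le_mul_of_nonneg_right (hκk z₁) (sq_nonneg _)
  have split : k z₁ * (b * (b - a)) - k z₂ * (a * (b - a))
      = k z₁ * (b - a) ^ 2 + s * (b - a) := by ring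
  rw [split]
  linarith

theorem le_weightForm_sub_weightForm (hk : Continuous k) (hC : ∀ x, |k x| ≤ C)
    (hκ : 0 < κ) (hκk : ∀ x, κ ≤ k x) (hL : LipschitzWith L k) {a : Lp ℝ 2 μ}
    (ha : ∀ᵐ x ∂μ, |a x| ≤ N) (b z₁ z₂ : Lp ℝ 2 μ) :
    κ / 2 * ‖b - a‖ ^ 2 - L ^ 2 / (2 * κ) * N ^ 2 * ‖z₁ - z₂‖ ^ 2
      ≤ weightForm k z₁ b (b - a) - weightForm k z₂ a (b - a) := by
  have hsq (f : Lp ℝ 2 μ) (r : ℝ) : Integrable (fun x => r * f x ^ 2) μ :=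
    (Lp.memLp f).integrable_sq.const_mul r
  have hint := integrable_weight_mul (μ := μ) hk hC
  unfold weightForm
  rw [norm_sq_eq_integral_sq, norm_sq_eq_integral_sq, ← integral_const_mul, ← integral_const_mul,
    ← integral_sub (hsq _ _) (hsq _ _), ← integral_sub (hint _ _ _) (hint _ _ _)]
  refine integral_mono_ae ((hsq _ _).sub (hsq _ _)) ((hint _ _ _).sub (hint _ _ _)) ?_
  filter_upwards [ha, Lp.coeFn_sub z₁ z₂, Lp.coeFn_sub b a] with x hax hz hba
  simp only [hz, hba, Pi.sub_apply]
  exact le_mul_sub_mul_of_lipschitzWith hκ hκk hL hax _ _ _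

end WeightForm

section Diffusion

variable {Ω : Set E3} {k : ℝ → ℝ} {C : ℝ}

theorem diffusion_eq_sum_weightForm (hk : Continuous k) (hC : ∀ x, |k x| ≤ C) (z : L2 Ω)
    (p q : H10 Ω) : diffusion k z p q = ∑ i, weightForm k z (pd Ω i p) (pd Ω i q) := by
  unfold diffusion weightForm
  rw [← integral_finsetSum _ fun i _ => integrable_weight_mul hk hC z _ _]
  simp only [Finset.mul_sum]

theorem continuous_diffusion (hk : Continuous k) (hC : ∀ x, |k x| ≤ C) :
    Continuous fun w : L2 Ω × H10 Ω × H10 Ω => diffusion k w.1 w.2.1 w.2.2 := by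
  simp only [diffusion_eq_sum_weightForm hk hC]
  refine continuous_finsetSum _ fun i _ => (continuous_weightForm hk hC).comp
    (continuous_fst.prodMk (Continuous.prodMk ?_ ?_)) <;> fun_prop

theorem diffusion_zero_right (hk : Continuous k) (hC : ∀ x, |k x| ≤ C) (z : L2 Ω) (p : H10 Ω) :
    diffusion k z p 0 = 0 := by
  rw [diffusion_eq_sum_weightForm hk hC]
  refine Finset.sum_eq_zero fun i _ => abs_nonpos_iff.1 ?_
  simpa only [map_zero, norm_zero, mul_zero] using abs_weightForm_le hC z (pd Ω i p) (pd Ω i 0)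

theorem norm_pd_le (i : Fin 3) (f : H10 Ω) : ‖pd Ω i f‖ ≤ ‖f‖ := by
  refine le_of_sq_le_sq ?_ (norm_nonneg _)
  calc ‖pd Ω i f‖ ^ 2 ≤ ∑ j, ‖pd Ω j f‖ ^ 2 :=
        Finset.single_le_sum (f := fun j => ‖pd Ω j f‖ ^ 2) (fun _ _ => by positivity)
          (Finset.mem_univ i)
    _ ≤ ‖val Ω f‖ ^ 2 + ∑ j, ‖pd Ω j f‖ ^ 2 := le_add_of_nonneg_left (sq_nonneg _)
    _ = ‖f‖ ^ 2 := (H10.norm_sq_eq f).symm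

theorem abs_diffusion_le (hk : Continuous k) (hC : ∀ x, |k x| ≤ C) (z : L2 Ω) (p q : H10 Ω) :
    |diffusion k z p q| ≤ 3 * C * (‖p‖ * ‖q‖) := by
  have hC0 : 0 ≤ C := (abs_nonneg _).trans (hC 0)
  rw [diffusion_eq_sum_weightForm hk hC]
  calc |∑ i, weightForm k z (pd Ω i p) (pd Ω i q)|
      ≤ ∑ i, |weightForm k z (pd Ω i p) (pd Ω i q)| := Finset.abs_sum_le_sum_abs _ _
    _ ≤ ∑ _i : Fin 3, C * (‖p‖ * ‖q‖) := by
        refine Finset.sum_le_sum fun i _ => (abs_weightForm_le hC _ _ _).trans ?_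
        gcongr <;> exact norm_pd_le i _
    _ = 3 * C * (‖p‖ * ‖q‖) := by
        rw [Fin.sum_const, nsmul_eq_mul, Nat.cast_ofNat, mul_assoc]

theorem integrable_diffusion {T : ℝ} (hk : Continuous k) (hC : ∀ x, |k x| ≤ C)
    {z : ℝ → L2 Ω} {p q : ℝ → H10 Ω} (hz : MemL2Time T z) (hp : MemL2Time T p)
    (hq : MemL2Time T q) :
    Integrable (fun t => diffusion k (z t) (p t) (q t)) (timeMeasure T) :=
  ((hp.norm.integrable_mul hq.norm).const_mul (3 * C)).mono'
    ((continuous_diffusion hk hC).comp_aestronglyMeasurable (hz.1.prodMk (hp.1.prodMk hq.1)))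
    (ae_of_all _ fun _ => abs_diffusion_le hk hC _ _ _)

theorem ae_abs_pd_le_w1InfNorm {p : H10 Ω} (hp : w1InfNorm p < ⊤) (i : Fin 3) :
    ∀ᵐ x ∂volume.restrict Ω, |pd Ω i p x| ≤ (w1InfNorm p).toReal := by
  have hle : eLpNorm (pd Ω i p) ⊤ (volume.restrict Ω) ≤ w1InfNorm p :=
    (Finset.single_le_sum (f := fun i => eLpNorm (pd Ω i p) ⊤ (volume.restrict Ω))
      (fun _ _ => bot_le) (Finset.mem_univ i)).trans le_add_self
  rw [eLpNorm_exponent_top] at hle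
  filter_upwards [ae_le_eLpNormEssSup (f := pd Ω i p) (μ := volume.restrict Ω)] with x hx
  simpa using ENNReal.toReal_mono hp.ne (hx.trans hle)

theorem le_diffusion_sub_diffusion (hk : Continuous k) (hC : ∀ x, |k x| ≤ C) {κ : ℝ}
    (hκ : 0 < κ) (hκk : ∀ x, κ ≤ k x) {L : ℝ≥0} (hL : LipschitzWith L k) {p : H10 Ω}
    (hp : w1InfNorm p < ⊤) (q : H10 Ω) (z₁ z₂ : L2 Ω) :
    κ / 2 * ∑ i, ‖pd Ω i (q - p)‖ ^ 2
        - 3 * (L ^ 2 / (2 * κ)) * (w1InfNorm p).toReal ^ 2 * ‖z₁ - z₂‖ ^ 2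
      ≤ diffusion k z₁ q (q - p) - diffusion k z₂ p (q - p) := by
  simp only [diffusion_eq_sum_weightForm hk hC, map_sub]
  rw [← Finset.sum_sub_distrib]
  refine le_trans (le_of_eq ?_) (Finset.sum_le_sum fun i _ =>
    le_weightForm_sub_weightForm hk hC hκ hκk hL (ae_abs_pd_le_w1InfNorm hp i) _ _ _)
  rw [Finset.sum_sub_distrib, ← Finset.mul_sum, Fin.sum_const, nsmul_eq_mul, Nat.cast_ofNat]
  ring

end Diffusion

/-! ### The difference of two weak solutions -/

section WeakSolutions

variable {Ω : Set E3} {T c₀ : ℝ} {k : ℝ → ℝ} {F : ℝ → L2Vec Ω} {S : ℝ → StrongDual ℝ (H10 Ω)}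
  {d₀ : L2 Ω} {u v : ℝ → H10Vec Ω} {p q : ℝ → H10 Ω}

theorem MemL2Time.clm_comp {X Y : Type*} [NormedAddCommGroup X] [NormedSpace ℝ X]
    [NormedAddCommGroup Y] [NormedSpace ℝ Y] (L : X →L[ℝ] Y) {f : ℝ → X} (hf : MemL2Time T f) :
    MemL2Time T (fun t => L (f t)) :=
  L.comp_memLp' hf

theorem MemL2Time.integrable_clm_apply₂ {X Y Z : Type*} [NormedAddCommGroup X] [NormedSpace ℝ X]
    [NormedAddCommGroup Y] [NormedSpace ℝ Y] [NormedAddCommGroup Z] [NormedSpace ℝ Z]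
    (B : X →L[ℝ] Y →L[ℝ] Z) {f : ℝ → X} {g : ℝ → Y} (hf : MemL2Time T f) (hg : MemL2Time T g) :
    Integrable (fun t => B (f t) (g t)) (timeMeasure T) :=
  memLp_one_iff_integrable.1 (B.memLp_of_bilin 1 hf hg)

theorem memL2Time_fluidContent (c₀ : ℝ) (hu : MemL2Time T u) (hp : MemL2Time T p) :
    MemL2Time T (fun t => fluidContent c₀ (u t) (p t)) :=
  ((hp.clm_comp (val Ω)).const_smul c₀).add (hu.clm_comp (dvg Ω))

/-- The embedding `L²(Ω) ⊂ V'` of `toDual`, as a bounded linear map. -/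
def toDualL (Ω : Set E3) : L2 Ω →L[ℝ] StrongDual ℝ (H10 Ω) :=
  (ContinuousLinearMap.precomp ℝ (val Ω)).comp (innerSL ℝ)

theorem toDualL_apply (f : L2 Ω) : toDualL Ω f = toDual f := rfl

theorem toDual_apply (f : L2 Ω) (r : H10 Ω) : toDual f r = inner ℝ f (val Ω r) := rfl

theorem IsWeakSolution.integral_elast_sub_solveElast_eq_zero (hΩ : Bornology.IsBounded Ω)
    (h₁ : IsWeakSolution T c₀ k F S d₀ u p) (h₂ : IsWeakSolution T c₀ k F S d₀ v q)
    {w : ℝ → H10Vec Ω} (hw : MemL2Time T w) :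
    ∫ t, elast (v t - u t - solveElast hΩ (val Ω (q t - p t))) (w t) ∂timeMeasure T = 0 := by
  have helast {u : ℝ → H10Vec Ω} (hu : MemL2Time T u) :
      Integrable (fun t => elast (u t) (w t)) (timeMeasure T) := by
    simpa only [elastL_apply] using hu.integrable_clm_apply₂ (elastL Ω) hw
  have hdvg {p : ℝ → H10 Ω} (hp : MemL2Time T p) :
      Integrable (fun t => inner ℝ (val Ω (p t)) (dvg Ω (w t))) (timeMeasure T) :=
    (hp.clm_comp (val Ω)).integrable_clm_apply₂ (innerSL ℝ) (hw.clm_comp (dvg Ω))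
  have expand (t : ℝ) : elast (v t - u t - solveElast hΩ (val Ω (q t - p t))) (w t)
      = (elast (v t) (w t) - inner ℝ (val Ω (q t)) (dvg Ω (w t)))
        - (elast (u t) (w t) - inner ℝ (val Ω (p t)) (dvg Ω (w t))) := by
    rw [sub_sub_sub_comm, ← inner_sub_left, ← map_sub, ← elast_solveElast hΩ]
    simp only [← elastL_apply, map_sub, sub_apply]
  simp only [expand]
  rw [integral_sub ((helast h₂.memL2_u).sub' (hdvg h₂.memL2_p))
      ((helast h₁.memL2_u).sub' (hdvg h₁.memL2_p)),
    integral_sub (helast h₂.memL2_u) (hdvg h₂.memL2_p),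
    integral_sub (helast h₁.memL2_u) (hdvg h₁.memL2_p),
    h₂.elasticity w hw, h₁.elasticity w hw, sub_self]

theorem IsWeakSolution.ae_sub_eq_solveElast (hΩ : Bornology.IsBounded Ω)
    (h₁ : IsWeakSolution T c₀ k F S d₀ u p) (h₂ : IsWeakSolution T c₀ k F S d₀ v q) :
    ∀ᵐ t ∂timeMeasure T, v t - u t = solveElast hΩ (val Ω (q t - p t)) := by
  have hP : MemL2Time T (fun t => q t - p t) := h₂.memL2_p.sub h₁.memL2_p
  have hW : MemL2Time T (fun t => v t - u t - solveElast hΩ (val Ω (q t - p t))) :=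
    (h₂.memL2_u.sub h₁.memL2_u).sub (hP.clm_comp ((solveElast hΩ).comp (val Ω)))
  have hWW := ae_apply_eq_zero_of_forall_integral_eq_zero
    (B := fun t => elastL Ω (v t - u t - solveElast hΩ (val Ω (q t - p t))))
    (fun t => map_zero _) (fun w hw => hW.integrable_clm_apply₂ (elastL Ω) hw)
    (fun w hw => by
      simpa only [elastL_apply] using h₁.integral_elast_sub_solveElast_eq_zero hΩ h₂ hw) hW
  obtain ⟨C, hC, hcoercive⟩ := elastL_isCoercive hΩ
  filter_upwards [hWW] with t ht
  have hle := hcoercive (v t - u t - solveElast hΩ (val Ω (q t - p t)))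
  rw [ht, mul_assoc] at hle
  exact sub_eq_zero.1 (norm_eq_zero.1 (mul_self_eq_zero.1
    (le_antisymm (nonpos_of_mul_nonpos_right hle hC) (mul_self_nonneg _))))

theorem IsWeakSolution.ae_fluidContent_sub (hΩ : Bornology.IsBounded Ω)
    (h₁ : IsWeakSolution T c₀ k F S d₀ u p) (h₂ : IsWeakSolution T c₀ k F S d₀ v q) :
    ∀ᵐ t ∂timeMeasure T, fluidContent c₀ (v t) (q t) - fluidContent c₀ (u t) (p t)
      = storage hΩ c₀ (val Ω (q t - p t)) := by
  filter_upwards [h₁.ae_sub_eq_solveElast hΩ h₂] with t ht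
  rw [storage_apply, ← ht, fluidContent, fluidContent, map_sub, map_sub, smul_sub]
  abel

theorem IsWeakSolution.ae_sub_eq_toDual_storage (hΩ : Bornology.IsBounded Ω)
    (h₁ : IsWeakSolution T c₀ k F S d₀ u p) (h₂ : IsWeakSolution T c₀ k F S d₀ v q)
    {ζ₁ ζ₂ : ℝ → StrongDual ℝ (H10 Ω)} (hζ₁ : MemL2Time T ζ₁) (hζ₂ : MemL2Time T ζ₂)
    (hd₁ : HasWeakTimeDeriv T (fun t => toDual (fluidContent c₀ (u t) (p t))) ζ₁)
    (hd₂ : HasWeakTimeDeriv T (fun t => toDual (fluidContent c₀ (v t) (q t))) ζ₂)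
    {g : ℝ → L2 Ω} (hg : MemL2Time T g)
    (hgd : HasWeakTimeDeriv T (fun t => val Ω (q t - p t)) g) :
    ∀ᵐ t ∂timeMeasure T, ζ₂ t - ζ₁ t = toDual (storage hΩ c₀ (g t)) := by
  set A := (toDualL Ω).comp (storage hΩ c₀)
  have hP : MemL2Time T (fun t => q t - p t) := h₂.memL2_p.sub h₁.memL2_p
  have hsub := hd₂.sub hd₁
    ((memL2Time_fluidContent c₀ h₂.memL2_u h₂.memL2_p).clm_comp (toDualL Ω)).integrable
    ((memL2Time_fluidContent c₀ h₁.memL2_u h₁.memL2_p).clm_comp (toDualL Ω)).integrable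
    hζ₂.integrable hζ₁.integrable
  have hstorage : HasWeakTimeDeriv T (fun t => A (val Ω (q t - p t))) (fun t => A (g t)) :=
    hgd.clm_comp A (hP.clm_comp (val Ω)).integrable hg.integrable
  refine (hsub.congr ?_).ae_eq hstorage (hζ₂.integrable.sub' hζ₁.integrable)
    (hg.clm_comp A).integrable
  filter_upwards [h₁.ae_fluidContent_sub hΩ h₂] with t ht
  rw [← toDualL_apply, ← toDualL_apply, ← map_sub, ht]
  rfl

theorem IsWeakSolution.ae_pressure_sub (hΩ : Bornology.IsBounded Ω) (hk : Continuous k) {C : ℝ}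
    (hC : ∀ x, |k x| ≤ C)
    (h₁ : IsWeakSolution T c₀ k F S d₀ u p) (h₂ : IsWeakSolution T c₀ k F S d₀ v q)
    {g : ℝ → L2 Ω} (hg : MemL2Time T g)
    (hgd : HasWeakTimeDeriv T (fun t => val Ω (q t - p t)) g) :
    ∀ᵐ t ∂timeMeasure T,
      diffusion k (fluidContent c₀ (v t) (q t)) (q t) (q t - p t)
        - diffusion k (fluidContent c₀ (u t) (p t)) (p t) (q t - p t)
        + inner ℝ (storage hΩ c₀ (g t)) (val Ω (q t - p t)) = 0 := by
  obtain ⟨ζ₁, hζ₁, hd₁, he₁⟩ := h₁.pressure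
  obtain ⟨ζ₂, hζ₂, hd₂, he₂⟩ := h₂.pressure
  have hi₁ {r : ℝ → H10 Ω} (hr : MemL2Time T r) := integrable_diffusion hk hC
    (memL2Time_fluidContent c₀ h₁.memL2_u h₁.memL2_p) h₁.memL2_p hr
  have hi₂ {r : ℝ → H10 Ω} (hr : MemL2Time T r) := integrable_diffusion hk hC
    (memL2Time_fluidContent c₀ h₂.memL2_u h₂.memL2_p) h₂.memL2_p hr
  have hj {ζ : ℝ → StrongDual ℝ (H10 Ω)} {r : ℝ → H10 Ω} (hζ : MemL2Time T ζ)
      (hr : MemL2Time T r) : Integrable (fun t => ζ t (r t)) (timeMeasure T) :=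
    hζ.integrable_clm_apply₂ (ContinuousLinearMap.id ℝ (StrongDual ℝ (H10 Ω))) hr
  have hzero := ae_apply_eq_zero_of_forall_integral_eq_zero
    (B := fun t r => (diffusion k (fluidContent c₀ (v t) (q t)) (q t) r + ζ₂ t r)
      - (diffusion k (fluidContent c₀ (u t) (p t)) (p t) r + ζ₁ t r))
    (fun t => by simp only [diffusion_zero_right hk hC, map_zero, add_zero, sub_zero])
    (fun r hr => ((hi₂ hr).add (hj hζ₂ hr)).sub ((hi₁ hr).add (hj hζ₁ hr)))
    (fun r hr => by
      rw [integral_sub ((hi₂ hr).fun_add (hj hζ₂ hr)) ((hi₁ hr).fun_add (hj hζ₁ hr)),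
        integral_add (hi₂ hr) (hj hζ₂ hr), integral_add (hi₁ hr) (hj hζ₁ hr),
        he₂ r hr, he₁ r hr, sub_self])
    (h₂.memL2_p.sub h₁.memL2_p)
  filter_upwards [hzero, h₁.ae_sub_eq_toDual_storage hΩ h₂ hζ₁ hζ₂ hd₁ hd₂ hg hgd]
    with t ht hζ
  rw [← toDual_apply, ← hζ, sub_apply]
  simp only [Pi.sub_apply] at ht
  linarith

theorem eq_left_of_ae_eq {X : Type*} [TopologicalSpace X] [T2Space X] (hT : 0 < T)
    {f g : ℝ → X} (hf : ContinuousOn f (Icc 0 T)) (hg : ContinuousOn g (Icc 0 T))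
    (h : f =ᵐ[timeMeasure T] g) : f 0 = g 0 := by
  rw [timeMeasure, restrict_Ioo_eq_restrict_Icc] at h
  exact Measure.eqOn_Icc_of_ae_eq volume hT.ne h hf hg (left_mem_Icc.2 hT.le)

theorem IsWeakSolution.inner_storage_initial_val_eq_zero (hΩ : Bornology.IsBounded Ω) (hT : 0 < T)
    (h₁ : IsWeakSolution T c₀ k F S d₀ u p) (h₂ : IsWeakSolution T c₀ k F S d₀ v q)
    {f : ℝ → L2 Ω} (hf : ContinuousOn f (Icc 0 T))
    (hfP : ∀ᵐ t ∂timeMeasure T, val Ω (q t - p t) = f t) (r : H10 Ω) :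
    inner ℝ (storage hΩ c₀ (f 0)) (val Ω r) = 0 := by
  obtain ⟨g₁, hac₁, hae₁, h0₁⟩ := h₁.initial r
  obtain ⟨g₂, hac₂, hae₂, h0₂⟩ := h₂.initial r
  have hcont := (hac₂.fun_sub hac₁).continuousOn
  rw [uIcc_of_le hT.le] at hcont
  have hstart : inner ℝ (storage hΩ c₀ (f 0)) (val Ω r) = g₂ 0 - g₁ 0 := by
    refine eq_left_of_ae_eq hT (f := fun t => inner ℝ (storage hΩ c₀ (f t)) (val Ω r))
      (by fun_prop) hcont ?_
    filter_upwards [hae₁, hae₂, hfP, h₁.ae_fluidContent_sub hΩ h₂] with t ht₁ ht₂ htf htζ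
    rw [ht₁, ht₂, ← inner_sub_left, htζ, htf]
  rw [hstart, h0₁, h0₂, sub_self]

theorem IsWeakSolution.inner_storage_initial_eq_zero (hΩ : Bornology.IsBounded Ω) (hT : 0 < T)
    (h₁ : IsWeakSolution T c₀ k F S d₀ u p) (h₂ : IsWeakSolution T c₀ k F S d₀ v q)
    {f : ℝ → L2 Ω} (hf : ContinuousOn f (Icc 0 T))
    (hfP : ∀ᵐ t ∂timeMeasure T, val Ω (q t - p t) = f t) :
    inner ℝ (storage hΩ c₀ (f 0)) (f 0) = 0 := by
  refine eq_left_of_ae_eq hT (f := fun t => inner ℝ (storage hΩ c₀ (f 0)) (f t))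
    (g := fun _ => 0) (by fun_prop) continuousOn_const ?_
  filter_upwards [hfP] with t ht
  rw [← ht]
  exact h₁.inner_storage_initial_val_eq_zero hΩ hT h₂ hf hfP _

theorem IsWeakSolution.ae_energy_le (hΩ : Bornology.IsBounded Ω) (hc₀ : 0 ≤ c₀)
    (hk : Continuous k) {C κ : ℝ} (hC : ∀ x, |k x| ≤ C) (hκ : 0 < κ) (hκk : ∀ x, κ ≤ k x)
    {L : ℝ≥0} (hL : LipschitzWith L k)
    (h₁ : IsWeakSolution T c₀ k F S d₀ u p) (h₂ : IsWeakSolution T c₀ k F S d₀ v q)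
    (hp : ∀ᵐ t ∂timeMeasure T, w1InfNorm (p t) < ⊤) {g : ℝ → L2 Ω} (hg : MemL2Time T g)
    (hgd : HasWeakTimeDeriv T (fun t => val Ω (q t - p t)) g) :
    ∀ᵐ t ∂timeMeasure T,
      κ / 2 * ∑ i, ‖pd Ω i (q t - p t)‖ ^ 2
          + inner ℝ (storage hΩ c₀ (g t)) (val Ω (q t - p t))
        ≤ 3 * (L ^ 2 / (2 * κ)) * ‖storage hΩ c₀‖ * (w1InfNorm (p t)).toReal ^ 2
          * inner ℝ (storage hΩ c₀ (val Ω (q t - p t))) (val Ω (q t - p t)) := by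
  filter_upwards [h₁.ae_pressure_sub hΩ hk hC h₂ hg hgd, hp, h₁.ae_fluidContent_sub hΩ h₂]
    with t hpressure hpt hfluid
  have hdiffusion := le_diffusion_sub_diffusion hk hC hκ hκk hL hpt (q t)
    (fluidContent c₀ (v t) (q t)) (fluidContent c₀ (u t) (p t))
  rw [hfluid] at hdiffusion
  have hstorage := mul_le_mul_of_nonneg_left
    (norm_apply_sq_le_of_isPositive (isPositive_storage hΩ hc₀) (val Ω (q t - p t)))
    (by positivity : 0 ≤ 3 * ((L : ℝ) ^ 2 / (2 * κ)) * (w1InfNorm (p t)).toReal ^ 2)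
  linarith

theorem ae_sub_eq_zero_of_mem_classW (hΩ : Bornology.IsBounded Ω) (hT : 0 < T) (hc₀ : 0 ≤ c₀)
    (hk : PermeabilityBounds k) {L : ℝ≥0} (hL : LipschitzWith L k)
    (hup : (u, p) ∈ classW T c₀ k F S d₀) (hvq : (v, q) ∈ classW T c₀ k F S d₀)
    (hp : MemL2W1Inf T p) : ∀ᵐ t ∂timeMeasure T, q t - p t = 0 := by
  obtain ⟨h₁, g₁, hg₁, hd₁⟩ := hup
  obtain ⟨h₂, g₂, hg₂, hd₂⟩ := hvq
  obtain ⟨hkc, κ, C, hκ, -, hkb⟩ := hk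
  have hC (x : ℝ) : |k x| ≤ C := by
    rw [abs_of_nonneg (hκ.le.trans (hkb x).1)]
    exact (hkb x).2
  have hP : MemL2Time T (fun t => q t - p t) := h₂.memL2_p.sub h₁.memL2_p
  have hg : MemL2Time T (fun t => g₂ t - g₁ t) := hg₂.sub hg₁
  have hgd : HasWeakTimeDeriv T (fun t => val Ω (q t - p t)) (fun t => g₂ t - g₁ t) := by
    simp only [map_sub]
    exact hd₂.sub hd₁ (h₂.memL2_p.clm_comp _).integrable (h₁.memL2_p.clm_comp _).integrable
      hg₂.integrable hg₁.integrable
  obtain ⟨c, hc⟩ := hgd.exists_ae_eq_primitive hT (hP.clm_comp (val Ω)).integrable hg.integrable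
  have hgi := (integrable_timeMeasure_iff hT.le).1 hg.integrable
  have hinit : inner ℝ (storage hΩ c₀ c) c = 0 := by
    have hcont := (absolutelyContinuousOnInterval_const_add_primitive hgi c).continuousOn
    rw [uIcc_of_le hT.le] at hcont
    simpa only [intervalIntegral.integral_same, add_zero] using
      h₁.inner_storage_initial_eq_zero hΩ hT h₂ hcont hc
  have hgrad : IntervalIntegrable (fun t => κ / 2 * ∑ i, ‖pd Ω i (q t - p t)‖ ^ 2) volume 0 T :=
    (integrable_timeMeasure_iff hT.le).1 ((integrable_finsetSum _ fun i _ =>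
      (hP.clm_comp (pd Ω i)).norm.integrable_sq).const_mul _)
  have hgrad_zero := ae_eq_zero_of_add_inner_apply_primitive_le hT.le (isPositive_storage hΩ hc₀)
    hgi hinit ((integrable_timeMeasure_iff hT.le).1 (hp.2.integrable_sq.const_mul
      (3 * (L ^ 2 / (2 * κ)) * ‖storage hΩ c₀‖))) (fun t => by positivity) hgrad
    (fun t => by positivity) (by
      filter_upwards [h₁.ae_energy_le hΩ hc₀ hkc hC hκ (fun x => (hkb x).1) hL h₂ hp.1 hg hgd, hc]
        with t ht htc
      rwa [htc] at ht)
  obtain ⟨K, -, hK⟩ := H10.exists_norm_sq_le hΩ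
  filter_upwards [hgrad_zero] with t ht
  have hle := hK (q t - p t)
  rw [(mul_eq_zero.1 ht).resolve_left (by positivity), mul_zero] at hle
  exact norm_eq_zero.1 (sq_eq_zero_iff.1 (le_antisymm hle (sq_nonneg _)))

end WeakSolutions

end Biot

end

theorem theorem2p3_general {Ω : Set E3} (hΩ : Bornology.IsBounded Ω) {T : ℝ} (hT : 0 < T)
    {c₀ : ℝ} (hc₀ : 0 ≤ c₀) {k : ℝ → ℝ} (hk : PermeabilityBounds k)
    (hkLip : ∃ L : ℝ≥0, LipschitzWith L k) {F : ℝ → L2Vec Ω} {S : ℝ → StrongDual ℝ (H10 Ω)}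
    {d₀ : L2 Ω} {u : ℝ → H10Vec Ω} {p : ℝ → H10 Ω} (hup : (u, p) ∈ classW T c₀ k F S d₀)
    (hp : MemL2W1Inf T p) {v : ℝ → H10Vec Ω} {q : ℝ → H10 Ω}
    (hvq : (v, q) ∈ classW T c₀ k F S d₀) :
    ∀ᵐ t ∂timeMeasure T, v t = u t ∧ q t = p t := by
  obtain ⟨L, hL⟩ := hkLip
  filter_upwards [ae_sub_eq_zero_of_mem_classW hΩ hT hc₀ hk hL hup hvq hp,
    hup.1.ae_sub_eq_solveElast hΩ hvq.1] with t hpressure hdisplacement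
  rw [hpressure, map_zero, map_zero] at hdisplacement
  exact ⟨sub_eq_zero.1 hdisplacement, sub_eq_zero.1 hpressure⟩

theorem theorem2p3 (Ω : Set E3) (hΩ : IsC2Domain Ω) (T : ℝ) (hT : 0 < T)
    (c₀ : ℝ) (hc₀ : 0 ≤ c₀)
    (k : ℝ → ℝ) (hk : PermeabilityBounds k) (hkLip : ∃ L : ℝ≥0, LipschitzWith L k)
    (F : ℝ → L2Vec Ω) (hF : MemL2Time T F) (hF' : MemH1Time T (fun t => toDualVec (F t)))
    (S : ℝ → StrongDual ℝ (H10 Ω)) (hS : MemL2Time T S)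
    (d₀ : L2 Ω)
    (u : ℝ → H10Vec Ω) (p : ℝ → H10 Ω) (hup : (u, p) ∈ classW T c₀ k F S d₀)
    (hp : MemL2W1Inf T p)
    (hcase : (∃ (u₀ : H10Vec Ω) (p₀ : L2 Ω), d₀ = dvg Ω u₀ + c₀ • p₀) ∨ 0 < c₀) :
    ∀ v q, (v, q) ∈ classW T c₀ k F S d₀ →
      ∀ᵐ t ∂timeMeasure T, v t = u t ∧ q t = p t := by
  intro v q hvq
  exact theorem2p3_general hΩ.isBounded hT hc₀ hk hkLip hup hp hvq
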